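/- Let $\mathcal F$ be the set of real-rational functions of $\mathbf z$ without poles on the unit circle; each $P\in\mathcal F$ has a unique expansion $P(\mathbf z)=\sum_{k\in\mathbb Z}p_k\mathbf z^{-k}$ on $|\mathbf z|=1$, acts on processes by $(P(\mathbf z)x)(t)=\sum_k p_{t-k}x(k)$, and is causal, $P\in\mathcal F^+$, if $p_k=0$ for all $k<0$. A linear dynamic influence model (LDIM) with finite node set $V$ consists of real, jointly wide-sense stationary, square-integrable vector processes $y=(y_v)_{v\in V}$ on $\mathbb Z$ (each $y_v$ of some finite dimension) with $$y=Q(\mathbf z)y+e,\qquad e=P(\mathbf z)u,$$ where $Q$ has entries in $\mathcal F$, $P$ has entries in $\mathcal F^+$ and is block diagonal with respect to the nodes, and $u=(u_v)_{v\in V}$ is white with $\Phi_u=\mathcal I$ (i.e. $\mathbf E[u(t)u(s)^T]=\delta_{ts}\mathcal I$). It is causal if the entries of $Q$ are in $\mathcal F^+$, and well-posed (causally well-posed) if for every $S\subseteq V$ the matrix $\mathcal I-Q_{SS}$ is invertible with inverse having entries in $\mathcal F$ (in $\mathcal F^+$). A directed graph $G$ on $V$ (self-loops and cycles allowed) is a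 graphical representation if $Q_{ji}=0$ whenever $(i,j)$ is not an edge. A path between $i$ and $j$ is a sequence of nodes $i=\pi_1,\dots,\pi_\ell=j$ with distinct ordered pairs $(\pi_p,\pi_{p+1})$, together with a choice, for each $p$, of an arrow $\pi_p\to\pi_{p+1}$ or $\pi_p\leftarrow\pi_{p+1}$ that is an edge of $G$; $\pi_p$ ($1<p<\ell$) is a collider if $\pi_{p-1}\to\pi_p\leftarrow\pi_{p+1}$ appears in the path. For disjoint $I,Z,J\subseteq V$, $Z$ d-separates $I$ and $J$ if every path between a node of $I$ and a node of $J$ contains a node of $Z$ that is not a collider, or a collider such that neither it nor any of its descendants is in $Z$. For $S\subseteq V$ let $\mathrm{tfspan}(y_S)$ (resp. $\mathrm{ctfspan}(y_S)$) be the set of the processes $W(\mathbf z)y_S$, $W$ a matrix with entries in $\mathcal F$ (resp. $\mathcal F^+$). A Wiener estimate (resp. causal Wiener estimate) of $y_J$ from $y_S$ is an element $q$ of this set, with the dimension of $y_J$, that minimizes $\mathbf E[(y_J-q)^T(y_J-q)]$ over it; if $q=W(\mathbf z)y_S$, then $W$ is called a (causal) Wiener filter. Write $\mathrm{wsep}(y_I,y_Z,y_J)$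 if (i) the Wiener estimates of $y_J$ from $(y_I,y_Z)$ and those from $y_Z$ are the same, and every element of $\mathrm{tfspan}(y_I,y_Z)$ is matched by an element of $\mathrm{tfspan}(y_Z)$ with mean square error that is no larger, so that the two minimization problems have the same infimum; and (ii) if the power spectral density of $(y_I,y_Z)$ is positive definite at every point of the unit circle, then the Wiener filter estimating $y_J$ from $(y_I,y_Z)$ exists, is unique, and its components acting on $y_I$ are zero. Write $\mathrm{cwsep}(y_I,y_Z,y_J)$ for the same with causal Wiener estimates, causal Wiener filters and $\mathrm{ctfspan}$. **Theorem.** Consider a well-posed LDIM with graphical representation $G$, and let $I,Z,J\subseteq V$ be pairwise disjoint. If $Z$ d-separates $I$ and $J$ in $G$, then $\mathrm{wsep}(y_I,y_Z,y_J)$. If moreover the LDIM is causal and causally well-posed, then also $\mathrm{cwsep}(y_I,y_Z,y_J)$. -/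

import Mathlib

open MeasureTheory
open scoped ComplexOrder

noncomputable section

/-! ### Directed graphs, oriented paths, d-separation -/

/-- A path between `i` and `j` in a directed graph: a sequence of nodes
`node 0, ..., node len` where each consecutive pair is joined by an edge of `G`, listed together
with the arrow by which it is traversed: `right p = true` means that
`node p → node (p+1)` appears in the path, `right p = false` that `node p ← node (p+1)` does
(if both edges are in `G`, these are different paths).
The ordered pairs `(node p, node (p+1))` are distinct. Values beyond `len` are irrelevant. -/
structure DiPath {V : Type*} (G : Digraph V) (i j : V) where
  len : ℕ
  node : ℕ → V
  right : ℕ → Bool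
  node_zero : node 0 = i
  node_len : node len = j
  adj_right : ∀ p < len, right p = true → G.Adj (node p) (node (p + 1))
  adj_left : ∀ p < len, right p = false → G.Adj (node (p + 1)) (node p)
  distinct : ∀ p q, p < q → q < len → (node p, node (p + 1)) ≠ (node q, node (q + 1))

/-- `node p` is a collider of the path: `node (p-1) → node p ← node (p+1)` appears in it. -/
def DiPath.IsCollider {V : Type*} {G : Digraph V} {i j : V} (π : DiPath G i j) (p : ℕ) : Prop :=
  0 < p ∧ p < π.len ∧ π.right (p - 1) = true ∧ π.right p = false

/-- `w` is a descendant of `v`: `w = v` or there is a directed chain from `v` to `w`. -/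
def IsDescendant {V : Type*} (G : Digraph V) (v w : V) : Prop :=
  Relation.ReflTransGen G.Adj v w

/-- The path contains a node of `Z` that is not a collider, or a collider none of whose
descendants (itself included) belongs to `Z`. -/
def DiPath.Blocked {V : Type*} {G : Digraph V} {i j : V} (π : DiPath G i j) (Z : Finset V) :
    Prop :=
  (∃ p ≤ π.len, π.node p ∈ Z ∧ ¬ π.IsCollider p) ∨
    (∃ p, π.IsCollider p ∧ ∀ w, IsDescendant G (π.node p) w → w ∉ Z)

/-- `Z` d-separates `I` and `J` in `G`. -/
def DSep {V : Type*} (G : Digraph V) (I Z J : Finset V) : Prop :=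
  ∀ i ∈ I, ∀ j ∈ J, ∀ π : DiPath G i j, π.Blocked Z

/-! ### Transfer functions -/

/-- The value of a real-rational function at a complex number. -/
def tfEval (P : RatFunc ℝ) (z : ℂ) : ℂ := RatFunc.eval (algebraMap ℝ ℂ) z P

/-- Real-rational transfer functions without poles on the unit circle. -/
def tfF : Set (RatFunc ℝ) :=
  {P | ∀ z : ℂ, ‖z‖ = 1 → P.denom.eval₂ (algebraMap ℝ ℂ) z ≠ 0}

/-- `p` is a bi-infinite real sequence with `P(z) = ∑ p_k z^{-k}` on the unit circle. -/
def IsImpulseResponse (P : RatFunc ℝ) (p : ℤ → ℝ) : Prop :=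
  ∀ z : ℂ, ‖z‖ = 1 → HasSum (fun k : ℤ => (p k : ℂ) * z ^ (-k)) (tfEval P z)

open Classical in
/-- The impulse response of a transfer function (it exists and is unique for `P ∈ tfF`;
the value is `0` if there is none). -/
def impulse (P : RatFunc ℝ) : ℤ → ℝ :=
  if h : ∃ p, IsImpulseResponse P p then h.choose else 0

/-- Causal transfer functions. -/
def tfFplus : Set (RatFunc ℝ) := {P | P ∈ tfF ∧ ∀ k < 0, impulse P k = 0}

/-! ### Processes and filters -/

/-- The output `W(z) x` of a transfer matrix: convolution with the impulse responses. -/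
def applyTF {Ω κ ι : Type*} [Fintype ι] (W : Matrix κ ι (RatFunc ℝ)) (x : ι → ℤ → Ω → ℝ) :
    κ → ℤ → Ω → ℝ :=
  fun a t ω => ∑ b, ∑' k : ℤ, impulse (W a b) (t - k) * x b k ω

/-- A vector of jointly wide-sense stationary real processes. -/
structure IsWSS {Ω ι : Type*} [MeasurableSpace Ω] (μ : Measure Ω) (x : ι → ℤ → Ω → ℝ) :
    Prop where
  memLp : ∀ a t, MemLp (x a t) 2 μ
  mean : ∀ a t, ∫ ω, x a t ω ∂μ = ∫ ω, x a 0 ω ∂μ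
  corr : ∀ a b t s, ∫ ω, x a (t + s) ω * x b t ω ∂μ = ∫ ω, x a s ω * x b 0 ω ∂μ

/-- White noise with power spectral density identically the identity matrix. -/
structure IsUnitWhite {Ω ι : Type*} [DecidableEq ι] [MeasurableSpace Ω] (μ : Measure Ω)
    (u : ι → ℤ → Ω → ℝ) : Prop where
  memLp : ∀ a t, MemLp (u a t) 2 μ
  corr : ∀ a b t s, ∫ ω, u a t ω * u b s ω ∂μ = if a = b ∧ t = s then 1 else 0

/-- The power spectral density matrix `∑_τ E[x(τ) x(0)ᵀ] z^{-τ}`. -/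
def psd {Ω ι : Type*} [MeasurableSpace Ω] (μ : Measure Ω) (x : ι → ℤ → Ω → ℝ) (z : ℂ) :
    Matrix ι ι ℂ :=
  fun a b => ∑' τ : ℤ, ((∫ ω, x a τ ω * x b 0 ω ∂μ : ℝ) : ℂ) * z ^ (-τ)

/-- The span of the processes `x` by transfer functions of the class `𝒯`, as a set of vector
processes indexed by `κ`; `𝒯 = tfF` is the tfspan and `𝒯 = tfFplus` the ctfspan.
Random variables are identified when they agree almost surely. -/
def tfSpan {Ω ι : Type*} [Fintype ι] [MeasurableSpace Ω] (μ : Measure Ω) (𝒯 : Set (RatFunc ℝ))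
    (x : ι → ℤ → Ω → ℝ) (κ : Type*) : Set (κ → ℤ → Ω → ℝ) :=
  {q | ∃ W : Matrix κ ι (RatFunc ℝ), (∀ a b, W a b ∈ 𝒯) ∧ ∀ a t, q a t =ᵐ[μ] applyTF W x a t}

/-- The mean square error `E[(x(t) - q(t))ᵀ (x(t) - q(t))]`. -/
def mse {Ω κ : Type*} [Fintype κ] [MeasurableSpace Ω] (μ : Measure Ω) (x q : κ → ℤ → Ω → ℝ)
    (t : ℤ) : ℝ :=
  ∫ ω, ∑ a, (x a t ω - q a t ω) ^ 2 ∂μ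

/-- `q` is the Wiener estimate of `x` from `y` within the class `𝒯` of transfer functions. -/
def IsWienerEstimate {Ω ι κ : Type*} [Fintype ι] [Fintype κ] [MeasurableSpace Ω]
    (μ : Measure Ω) (𝒯 : Set (RatFunc ℝ)) (y : ι → ℤ → Ω → ℝ) (x q : κ → ℤ → Ω → ℝ) : Prop :=
  q ∈ tfSpan μ 𝒯 y κ ∧ ∀ q' ∈ tfSpan μ 𝒯 y κ, ∀ t, mse μ x q t ≤ mse μ x q' t

/-- `W` is the Wiener filter estimating `x` from `y` within the class `𝒯`. -/
def IsWienerFilter {Ω ι κ : Type*} [Fintype ι] [Fintype κ] [MeasurableSpace Ω]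
    (μ : Measure Ω) (𝒯 : Set (RatFunc ℝ)) (y : ι → ℤ → Ω → ℝ) (x : κ → ℤ → Ω → ℝ)
    (W : Matrix κ ι (RatFunc ℝ)) : Prop :=
  (∀ a b, W a b ∈ 𝒯) ∧ IsWienerEstimate μ 𝒯 y x (applyTF W y)

/-! ### Networks of vector processes -/

/-- Scalar components of a vector signal with one block of dimension `d v` for each node `v`. -/
abbrev Comp {V : Type*} (d : V → ℕ) := (v : V) × Fin (d v)

/-- Scalar components of the nodes in `S`. -/
abbrev CompOn {V : Type*} (d : V → ℕ) (S : Finset V) := {c : Comp d // c.1 ∈ S}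

/-- The vector signal of the nodes in `S`. -/
def restrictTo {V Ω : Type*} {d : V → ℕ} (y : Comp d → ℤ → Ω → ℝ) (S : Finset V) :
    CompOn d S → ℤ → Ω → ℝ :=
  fun c => y c.1

/-- The Wiener estimate of `y_J` from `(y_I, y_Z)` and the one from `y_Z` are identical. -/
def EstimatesCoincide {V Ω : Type*} [Fintype V] [DecidableEq V] [MeasurableSpace Ω]
    (μ : Measure Ω) (𝒯 : Set (RatFunc ℝ)) {d : V → ℕ} (y : Comp d → ℤ → Ω → ℝ)
    (I Z J : Finset V) : Prop :=
  ∀ q : CompOn d J → ℤ → Ω → ℝ,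
    IsWienerEstimate μ 𝒯 (restrictTo y (I ∪ Z)) (restrictTo y J) q ↔
      IsWienerEstimate μ 𝒯 (restrictTo y Z) (restrictTo y J) q

/-- There is exactly one Wiener filter estimating `y_J` from `(y_I, y_Z)`, and all its
components acting on `y_I` are zero. -/
def FilterVanishesOn {V Ω : Type*} [Fintype V] [DecidableEq V] [MeasurableSpace Ω]
    (μ : Measure Ω) (𝒯 : Set (RatFunc ℝ)) {d : V → ℕ} (y : Comp d → ℤ → Ω → ℝ)
    (I Z J : Finset V) : Prop :=
  ∃ W : Matrix (CompOn d J) (CompOn d (I ∪ Z)) (RatFunc ℝ),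
    IsWienerFilter μ 𝒯 (restrictTo y (I ∪ Z)) (restrictTo y J) W ∧
    (∀ W', IsWienerFilter μ 𝒯 (restrictTo y (I ∪ Z)) (restrictTo y J) W' → W' = W) ∧
    ∀ a b, b.1.1 ∈ I → W a b = 0

/-- Adding `y_I` to `y_Z` does not improve the least squares problem for `y_J`: every estimate
from `(y_I, y_Z)` is matched by one from `y_Z` (so the infima of the two problems agree, also if
they are not attained). -/
def NoImprovement {V Ω : Type*} [Fintype V] [DecidableEq V] [MeasurableSpace Ω]
    (μ : Measure Ω) (𝒯 : Set (RatFunc ℝ)) {d : V → ℕ} (y : Comp d → ℤ → Ω → ℝ)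
    (I Z J : Finset V) : Prop :=
  ∀ q ∈ tfSpan μ 𝒯 (restrictTo y (I ∪ Z)) (CompOn d J),
    ∃ q' ∈ tfSpan μ 𝒯 (restrictTo y Z) (CompOn d J),
      ∀ t, mse μ (restrictTo y J) q' t ≤ mse μ (restrictTo y J) q t

/-- Wiener separation within the class `𝒯`: the two least squares problems have the same
optimal value and the same solutions (Wiener estimates) and, whenever the spectral
density of `(y_I, y_Z)` is positive definite on the unit circle (so that the Wiener filter is
well defined), the components of the Wiener filter acting on `y_I` vanish. -/
def WienerSepIn {V Ω : Type*} [Fintype V] [DecidableEq V] [MeasurableSpace Ω]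
    (μ : Measure Ω) (𝒯 : Set (RatFunc ℝ)) {d : V → ℕ} (y : Comp d → ℤ → Ω → ℝ)
    (I Z J : Finset V) : Prop :=
  EstimatesCoincide μ 𝒯 y I Z J ∧ NoImprovement μ 𝒯 y I Z J ∧
    ((∀ z : ℂ, ‖z‖ = 1 → (psd μ (restrictTo y (I ∪ Z)) z).PosDef) →
      FilterVanishesOn μ 𝒯 y I Z J)

/-- Non-causal Wiener separation. -/
def WSep {V Ω : Type*} [Fintype V] [DecidableEq V] [MeasurableSpace Ω] (μ : Measure Ω)
    {d : V → ℕ} (y : Comp d → ℤ → Ω → ℝ) (I Z J : Finset V) : Prop :=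
  WienerSepIn μ tfF y I Z J

/-- Causal Wiener separation. -/
def CWSep {V Ω : Type*} [Fintype V] [DecidableEq V] [MeasurableSpace Ω] (μ : Measure Ω)
    {d : V → ℕ} (y : Comp d → ℤ → Ω → ℝ) (I Z J : Finset V) : Prop :=
  WienerSepIn μ tfFplus y I Z J

/-! ### Linear dynamic influence models -/

/-- A linear dynamic influence model `y = Q(z) y + e`, `e = P(z) u`, with node set `V`; the node
signal `y_v` has dimension `d v` and the input `u_v` has dimension `m v`. -/
structure LDIM {V Ω : Type*} [Fintype V] [DecidableEq V] [MeasurableSpace Ω] (μ : Measure Ω)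
    (d m : V → ℕ) where
  Q : Matrix (Comp d) (Comp d) (RatFunc ℝ)
  P : Matrix (Comp d) (Comp m) (RatFunc ℝ)
  u : Comp m → ℤ → Ω → ℝ
  y : Comp d → ℤ → Ω → ℝ
  Q_mem : ∀ a b, Q a b ∈ tfF
  P_mem : ∀ a b, P a b ∈ tfFplus
  P_blockDiagonal : ∀ a b, a.1 ≠ b.1 → P a b = 0
  u_white : IsUnitWhite μ u
  y_wss : IsWSS μ y
  dynamics : ∀ a t, y a t =ᵐ[μ] fun ω => applyTF Q y a t ω + applyTF P u a t ω

namespace LDIM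

variable {V Ω : Type*} [Fintype V] [DecidableEq V] [MeasurableSpace Ω] {μ : Measure Ω}
  {d m : V → ℕ}

/-- All entries of `Q` are causal. -/
def IsCausal (L : LDIM μ d m) : Prop := ∀ a b, L.Q a b ∈ tfFplus

/-- For every set `S` of nodes, `𝓘 - Q_SS` has an inverse with entries in `𝒯`. -/
def InvertibleIn (L : LDIM μ d m) (𝒯 : Set (RatFunc ℝ)) : Prop :=
  ∀ S : Finset V, ∃ N : Matrix (CompOn d S) (CompOn d S) (RatFunc ℝ),
    (1 - L.Q.submatrix Subtype.val Subtype.val) * N = 1 ∧ ∀ a b, N a b ∈ 𝒯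

/-- Well-posedness: the inverses exist and have no poles on the unit circle. -/
def IsWellPosed (L : LDIM μ d m) : Prop := L.InvertibleIn tfF

/-- Causal well-posedness: the inverses exist and are causal, without poles on the circle. -/
def IsCausallyWellPosed (L : LDIM μ d m) : Prop := L.InvertibleIn tfFplus

/-- `G` is a graphical representation: `Q_ji = 0` unless `G` has the edge `i → j`. -/
def IsRepresentedBy (L : LDIM μ d m) (G : Digraph V) : Prop :=
  ∀ i j, ¬ G.Adj i j → ∀ (a : Fin (d j)) (b : Fin (d i)), L.Q ⟨j, a⟩ ⟨i, b⟩ = 0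

end LDIM

end

noncomputable section

/-! ### Convolution of absolutely summable sequences -/

/-! A process is treated as a bounded sequence in the Hilbert space `Lp ℝ 2 μ`, on which the ring
`tfRing` acts by convolution (`Represents.filter`). Estimates become elements of spans over a
subring `T`, either all of `tfRing` or `causalRing`, so both halves of the theorem are a single
argument in linear algebra over `T` (`LDIM.wienerSepIn`).

Graph. Among the ancestors of `I ∪ Z ∪ J` outside `Z`, let `K` be the nodes reached from `I` along
active walks and `K'` the others. d-separation puts `J` in `K'` and rules out edges between `K` and
`K'` as well as common children in `Z`. Hence `Z` splits into `ZK` and `ZK'` such that the relevant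
parents of `K ∪ ZK` are in `K ∪ Z` and those of `K' ∪ ZK'` are in `K' ∪ Z` (`DSep.exists_sides`).

Algebra. Inverting `1 - Q` on `K` writes `y_K` as a combination of `y_Z` plus a response to the
inputs `e` of `K`; likewise for `K'`. Each node of `Z` then has an innovation that lies in the span
of `y_Z` and involves the inputs of one side only, and inverting `1 - Q` on `K ∪ K' ∪ Z` writes
`y_Z` through these innovations. So the span of `y_Z` is the sum of a part on the side of `K` and a
part on the side of `K'`. Given an estimate `q` of a component `y_j` from `(y_K, y_Z)`, exchange its
`K`-part for that of the prediction of `y_j`: the resulting `q'` uses `y_Z` only, `y_j - q'`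
involves inputs of the side of `K'` and `q - q'` inputs of the side of `K`
(`exists_estimate_of_partition`). Inputs of different nodes are uncorrelated at all times, so `‖y_j
- q‖² = ‖y_j - q'‖² + ‖q - q'‖²`. This gives equal infima and equal minimizers, whether or not
minimizers exist.

Filters. The spectrum of `y` is rational, and positive definiteness on the circle makes its
determinant a unit of `tfRing`. The Hilbert space projection is then given by a rational filter
(`exists_wiener_filter`), in the causal case by a Wiener-Hopf argument. An invertible spectrum also
excludes linear relations between the observed signals; since the optimal estimate is one from `y_Z`
alone, the components on `y_I` are zero. -/

theorem summable_norm_smul_of_le_one {𝕜 B : Type*} [NormedField 𝕜] [SeminormedAddCommGroup B]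
    [NormedSpace 𝕜 B] {S : ℤ → B} (hS : ∀ a, ‖S a‖ ≤ 1) {p : ℤ → 𝕜}
    (hp : Summable fun k => ‖p k‖) : Summable fun k => ‖p k • S k‖ := by
  refine hp.of_nonneg_of_le (fun _ => norm_nonneg _) fun k => ?_
  rw [norm_smul]
  exact mul_le_of_le_one_right (norm_nonneg _) (hS k)

theorem summable_conv_fiber {𝕜 : Type*} [NormedField 𝕜] [CompleteSpace 𝕜] {p q : ℤ → 𝕜}
    (hp : Summable fun k => ‖p k‖) (hq : Summable fun k => ‖q k‖) (n : ℤ) :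
    Summable fun k => p k * q (n - k) := by
  have h := summable_mul_of_summable_norm hp hq
  have hinj : Function.Injective fun k : ℤ => (k, n - k) := fun a b hab => by simp_all
  simpa only [Function.comp_def] using h.comp_injective hinj

/-- Series over a bounded representation of `ℤ` multiply by convolution of the coefficients. -/
theorem hasSum_conv_smul {𝕜 B : Type*} [NormedField 𝕜] [CompleteSpace 𝕜] [NormedRing B]
    [NormedAlgebra 𝕜 B] [CompleteSpace B] {S : ℤ → B} (hS : ∀ a b, S (a + b) = S a * S b)
    (hS1 : ∀ a, ‖S a‖ ≤ 1) {p q : ℤ → 𝕜} (hp : Summable fun k => ‖p k‖)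
    (hq : Summable fun k => ‖q k‖) :
    HasSum (fun n => (∑' k, p k * q (n - k)) • S n) ((∑' k, p k • S k) * ∑' k, q k • S k) := by
  have hp' := summable_norm_smul_of_le_one hS1 hp
  have hq' := summable_norm_smul_of_le_one hS1 hq
  have h := (summable_mul_of_summable_norm hp' hq').hasSum
  rw [← tsum_mul_tsum_of_summable_norm hp' hq'] at h
  let e : ℤ × ℤ ≃ ℤ × ℤ :=
    { toFun := fun x => (x.2, x.1 - x.2)
      invFun := fun x => (x.1 + x.2, x.1)
      left_inv := fun x => by simp
      right_inv := fun x => by simp }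
  refine HasSum.prod_fiberwise (e.hasSum_iff.2 h) fun n => ?_
  convert! (summable_conv_fiber hp hq n).hasSum.smul_const (S n) using 2 with k
  simp [e, smul_smul, mul_comm, ← hS]

/-! ### Laurent series on the unit circle -/

theorem summable_norm_of_hasSum_zpow {c : ℤ → ℂ} {s : ℂ}
    (h : HasSum (fun k : ℤ => c k * (1 : ℂ) ^ (-k)) s) : Summable fun k => ‖c k‖ := by
  have := h.summable.norm
  simpa using this

/-- Functions on the unit circle with an absolutely summable Laurent series. -/
def HasLaurent (f : ℂ → ℂ) (c : ℤ → ℂ) : Prop :=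
  ∀ z : ℂ, ‖z‖ = 1 → HasSum (fun k : ℤ => c k * z ^ (-k)) (f z)

theorem HasLaurent.summable {f : ℂ → ℂ} {c : ℤ → ℂ} (h : HasLaurent f c) :
    Summable fun k => ‖c k‖ :=
  summable_norm_of_hasSum_zpow (h 1 (by simp))

theorem norm_zpow_of_norm_one {z : ℂ} (hz : ‖z‖ = 1) (k : ℤ) : ‖z ^ k‖ = 1 := by
  simp [norm_zpow, hz]

theorem ne_zero_of_norm_one {z : ℂ} (hz : ‖z‖ = 1) : z ≠ 0 := by
  rintro rfl
  simp at hz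

theorem HasLaurent.mul {f g : ℂ → ℂ} {c d : ℤ → ℂ} (hf : HasLaurent f c) (hg : HasLaurent g d) :
    HasLaurent (fun z => f z * g z) (fun n => ∑' k, c k * d (n - k)) := by
  intro z hz
  have h := hasSum_conv_smul (𝕜 := ℂ) (B := ℂ) (S := fun k => z ^ (-k))
    (fun a b => by rw [neg_add, zpow_add₀ (ne_zero_of_norm_one hz)])
    (fun a => (norm_zpow_of_norm_one hz _).le) hf.summable hg.summable
  simp only [smul_eq_mul] at h
  rwa [(hf z hz).tsum_eq, (hg z hz).tsum_eq] at h

theorem HasLaurent.add {f g : ℂ → ℂ} {c d : ℤ → ℂ} (hf : HasLaurent f c) (hg : HasLaurent g d) :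
    HasLaurent (fun z => f z + g z) (fun n => c n + d n) := by
  intro z hz
  simpa [add_mul] using (hf z hz).add (hg z hz)

theorem HasLaurent.congr {f g : ℂ → ℂ} {c : ℤ → ℂ} (hf : HasLaurent f c)
    (h : ∀ z : ℂ, ‖z‖ = 1 → f z = g z) : HasLaurent g c := by
  intro z hz
  rw [← h z hz]
  exact hf z hz

theorem hasLaurent_zpow (a : ℂ) (n : ℤ) :
    HasLaurent (fun z => a * z ^ (-n)) (fun k => if k = n then a else 0) := by
  intro z _
  have h := hasSum_ite_eq n (a * z ^ (-n))
  convert! h using 2 with k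
  split_ifs with hk <;> simp [hk]

/-- Absolute summability gives uniform convergence on the circle, so the series can be paired
termwise in `L²` with the Fourier monomials; orthonormality isolates each coefficient. -/
theorem HasLaurent.coeff_eq_zero {c : ℤ → ℂ} (h : HasLaurent 0 c) : c = 0 := by
  have : Fact (0 < (1 : ℝ)) := ⟨one_pos⟩
  have hs : Summable fun k : ℤ => c k • (fourier (-k) : C(AddCircle (1 : ℝ), ℂ)) := by
    refine Summable.of_norm ?_
    simpa only [norm_smul, fourier_norm, mul_one] using h.summable
  have h0 : HasSum (fun k : ℤ => c k • (fourier (-k) : C(AddCircle (1 : ℝ), ℂ))) 0 := by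
    have := hs.hasSum
    convert this
    ext x
    have h1 := (ContinuousMap.hasSum_apply this x)
    have h2 := h (AddCircle.toCircle x) (Circle.norm_coe _)
    refine h2.unique ?_
    convert! h1 using 2 with k
    rw [ContinuousMap.smul_apply, fourier_apply, AddCircle.toCircle_zsmul, Circle.coe_zpow,
      smul_eq_mul]
  have h1 := h0.mapL (ContinuousMap.toLp (E := ℂ) 2 AddCircle.haarAddCircle ℂ)
  simp only [map_smul, map_zero] at h1
  ext j
  have h2 := h1.mapL (innerSL ℂ (fourierLp (T := (1 : ℝ)) 2 (-j)))
  have h3 : ∀ k, innerSL ℂ (fourierLp (T := (1 : ℝ)) 2 (-j)) (fourierLp 2 (-k)) =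
      if k = j then 1 else 0 := by
    intro k
    have := orthonormal_iff_ite.1 (orthonormal_fourier (T := (1 : ℝ))) (-j) (-k)
    rw [innerSL_apply_apply, this]
    simp [eq_comm]
  have h4 : HasSum (fun k => if k = j then c j else 0) (0 : ℂ) := by
    convert! h2 using 1
    · ext k
      have := h3 k
      simp only [fourierLp] at this
      rw [map_smul, fourierLp, this]
      split_ifs with hk <;> simp [hk]
    · simp
  exact (h4.unique (hasSum_ite_eq j (c j))).symm

theorem HasLaurent.unique {f : ℂ → ℂ} {c d : ℤ → ℂ} (hc : HasLaurent f c) (hd : HasLaurent f d) :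
    c = d := by
  have h : HasLaurent 0 (fun k => c k - d k) := by
    intro z hz
    simpa [sub_mul] using (hc z hz).sub (hd z hz)
  ext k
  exact sub_eq_zero.1 (congrFun h.coeff_eq_zero k)

/-- A geometric series: in `a / z` if the pole is inside the circle, in `z / a` if it is outside. -/
theorem exists_hasLaurent_inv_sub {a : ℂ} (ha : ‖a‖ ≠ 1) :
    ∃ c, HasLaurent (fun z => (z - a)⁻¹) c := by
  rcases lt_or_gt_of_ne ha with ha | ha
  · refine ⟨fun k => if 1 ≤ k then a ^ (k - 1) else 0, fun z hz => ?_⟩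
    have hz0 := ne_zero_of_norm_one hz
    have hinj : Function.Injective fun n : ℕ => (n : ℤ) + 1 := fun m n h => by simpa using h
    rw [← hinj.hasSum_iff]
    · have h := (hasSum_geometric_of_norm_lt_one (ξ := a * z⁻¹) (by simpa [hz] using ha)).mul_right
        z⁻¹
      convert! h using 1
      · ext n
        have : (1 : ℤ) ≤ n + 1 := by lia
        simp only [Function.comp, if_pos this, add_sub_cancel_right, zpow_natCast, mul_pow]
        rw [neg_add, zpow_add₀ hz0, zpow_neg, zpow_natCast, zpow_neg_one, inv_pow]
        ring
      · rw [← mul_inv]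
        field_simp
    · intro k hk
      have : ¬ 1 ≤ k := fun h => hk ⟨(k - 1).toNat, by simp; lia⟩
      simp [this]
  · refine ⟨fun k => if k ≤ 0 then -a ^ (k - 1) else 0, fun z hz => ?_⟩
    have hz0 := ne_zero_of_norm_one hz
    have ha0 : a ≠ 0 := by
      rintro rfl
      simp at ha
      linarith
    have hza : z - a ≠ 0 := by
      intro h
      rw [sub_eq_zero.1 h] at hz
      linarith
    have hinj : Function.Injective fun n : ℕ => -(n : ℤ) := fun m n h => by simpa using h
    rw [← hinj.hasSum_iff]
    · have h := (hasSum_geometric_of_norm_lt_one (ξ := z * a⁻¹)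
        (by simpa [hz] using inv_lt_one_of_one_lt₀ ha)).mul_right (-a⁻¹)
      convert! h using 1
      · ext n
        have : -(n : ℤ) ≤ 0 := by lia
        simp only [Function.comp, if_pos this, mul_pow, neg_neg, zpow_natCast]
        rw [zpow_sub₀ ha0, zpow_neg, zpow_natCast, zpow_one, inv_pow]
        ring
      · have : 1 - z * a⁻¹ ≠ 0 := by
          intro h
          apply hza
          field_simp at h
          linear_combination -h
        rw [inv_eq_iff_eq_inv, mul_inv, inv_inv, inv_neg, inv_inv]
        field_simp
        ring
    · intro k hk
      have : ¬ k ≤ 0 := fun h => hk ⟨(-k).toNat, by simp; lia⟩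
      simp [this]

theorem exists_hasLaurent_inv_polynomial (s : Multiset ℂ) (hs : ∀ a ∈ s, ‖a‖ ≠ 1) :
    ∃ c, HasLaurent (fun z => ((s.map fun a => z - a).prod)⁻¹) c := by
  induction s using Multiset.induction_on with
  | empty =>
    exact ⟨_, (hasLaurent_zpow 1 0).congr fun z _ => by simp⟩
  | cons a s ih =>
    obtain ⟨c, hc⟩ := ih fun b hb => hs b (Multiset.mem_cons_of_mem hb)
    obtain ⟨d, hd⟩ := exists_hasLaurent_inv_sub (hs a (Multiset.mem_cons_self a s))
    exact ⟨_, (hd.mul hc).congr fun z _ => by simp [mul_comm]⟩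

theorem exists_hasLaurent_polynomial (p : Polynomial ℂ) :
    ∃ c, HasLaurent (fun z => p.eval z) c := by
  induction p using Polynomial.induction_on' with
  | add p q hp hq =>
    obtain ⟨c, hc⟩ := hp
    obtain ⟨d, hd⟩ := hq
    exact ⟨_, (hc.add hd).congr fun z _ => by simp⟩
  | monomial n a => exact ⟨_, (hasLaurent_zpow a (-n)).congr fun z _ => by simp⟩

/-- Over `ℂ` the denominator splits into linear factors with no root on the circle; the expansions
of their inverses and of the numerator multiply by convolution. -/
theorem exists_hasLaurent_tfEval {P : RatFunc ℝ} (hP : P ∈ tfF) :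
    ∃ c, HasLaurent (tfEval P) c := by
  set q : Polynomial ℂ := P.denom.map (algebraMap ℝ ℂ) with hq
  have hq0 : q ≠ 0 := (Polynomial.map_ne_zero_iff (algebraMap ℝ ℂ).injective).2 P.denom_ne_zero
  have hroot : ∀ a ∈ q.roots, ‖a‖ ≠ 1 := by
    intro a ha h1
    refine hP a h1 ?_
    rw [← Polynomial.eval_map]
    exact (Polynomial.mem_roots hq0).1 ha
  obtain ⟨c, hc⟩ := exists_hasLaurent_inv_polynomial _ hroot
  obtain ⟨d, hd⟩ := exists_hasLaurent_polynomial
    (Polynomial.C (q.leadingCoeff)⁻¹ * P.num.map (algebraMap ℝ ℂ))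
  refine ⟨_, (hd.mul hc).congr fun z _ => ?_⟩
  have hfac : q.eval z = q.leadingCoeff * (q.roots.map fun a => z - a).prod := by
    conv_lhs => rw [(IsAlgClosed.splits q).eq_prod_roots]
    simp [Polynomial.eval_multiset_prod]
  rw [tfEval, RatFunc.eval, ← Polynomial.eval_map, ← Polynomial.eval_map, ← hq, hfac]
  simp [div_eq_mul_inv]
  ring

theorem tfEval_conj (P : RatFunc ℝ) (z : ℂ) :
    tfEval P (starRingEnd ℂ z) = starRingEnd ℂ (tfEval P z) := by
  have h : ∀ p : Polynomial ℝ, p.eval₂ (algebraMap ℝ ℂ) (starRingEnd ℂ z) =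
      starRingEnd ℂ (p.eval₂ (algebraMap ℝ ℂ) z) := by
    intro p
    rw [Polynomial.hom_eval₂]
    congr 1
    ext x
    simp
  simp [tfEval, RatFunc.eval, h]

/-- By `tfEval_conj`, the conjugate of the expansion at the conjugate point is a second expansion of
the same value. The average of the two has the real parts as coefficients. -/
theorem exists_isImpulseResponse {P : RatFunc ℝ} (hP : P ∈ tfF) : ∃ p, IsImpulseResponse P p := by
  obtain ⟨c, hc⟩ := exists_hasLaurent_tfEval hP
  refine ⟨fun k => (c k).re, fun z hz => ?_⟩
  have h1 := hc z hz
  have h2 := Complex.hasSum_conj'.2 (hc (starRingEnd ℂ z) (by simpa using hz))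
  rw [tfEval_conj] at h2
  simp only [map_mul, map_zpow₀, Complex.conj_conj] at h2
  have h3 := (h1.add h2).div_const 2
  convert! h3 using 1
  · ext k
    rw [Complex.re_eq_add_conj]
    ring
  · simp

theorem IsImpulseResponse.hasLaurent {P : RatFunc ℝ} {p : ℤ → ℝ} (h : IsImpulseResponse P p) :
    HasLaurent (tfEval P) (fun k => (p k : ℂ)) := h

theorem IsImpulseResponse.unique {P : RatFunc ℝ} {p q : ℤ → ℝ} (hp : IsImpulseResponse P p)
    (hq : IsImpulseResponse P q) : p = q := by
  ext k
  exact_mod_cast congrFun (hp.hasLaurent.unique hq.hasLaurent) k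

theorem isImpulseResponse_impulse {P : RatFunc ℝ} (hP : P ∈ tfF) :
    IsImpulseResponse P (impulse P) := by
  have h := exists_isImpulseResponse hP
  rw [impulse, dif_pos h]
  exact h.choose_spec

theorem IsImpulseResponse.impulse_eq {P : RatFunc ℝ} (hP : P ∈ tfF) {p : ℤ → ℝ}
    (hp : IsImpulseResponse P p) : impulse P = p :=
  (isImpulseResponse_impulse hP).unique hp

theorem summable_norm_impulse {P : RatFunc ℝ} (hP : P ∈ tfF) :
    Summable fun k => ‖impulse P k‖ := by
  simpa using (isImpulseResponse_impulse hP).hasLaurent.summable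

/-! ### The ring of transfer functions without poles on the unit circle -/

theorem mem_tfF_of_denom_dvd {P : RatFunc ℝ} {q : Polynomial ℝ} (h : P.denom ∣ q)
    (hq : ∀ z : ℂ, ‖z‖ = 1 → q.eval₂ (algebraMap ℝ ℂ) z ≠ 0) : P ∈ tfF :=
  fun z hz h0 => hq z hz (Polynomial.eval₂_eq_zero_of_dvd_of_eval₂_eq_zero _ z h h0)

theorem algebraMap_mem_tfF (p : Polynomial ℝ) : algebraMap (Polynomial ℝ) (RatFunc ℝ) p ∈ tfF := by
  intro z _
  simp

theorem mul_mem_tfF {P Q : RatFunc ℝ} (hP : P ∈ tfF) (hQ : Q ∈ tfF) : P * Q ∈ tfF :=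
  mem_tfF_of_denom_dvd (RatFunc.denom_mul_dvd P Q) fun z hz => by
    rw [Polynomial.eval₂_mul]
    exact mul_ne_zero (hP z hz) (hQ z hz)

/-- The ring of real-rational functions without poles on the unit circle. -/
def tfRing : Subring (RatFunc ℝ) where
  carrier := tfF
  mul_mem' := mul_mem_tfF
  one_mem' := by simpa using algebraMap_mem_tfF 1
  add_mem' {P Q} hP hQ := mem_tfF_of_denom_dvd (RatFunc.denom_add_dvd P Q) fun z hz => by
    rw [Polynomial.eval₂_mul]
    exact mul_ne_zero (hP z hz) (hQ z hz)
  zero_mem' := by simpa using algebraMap_mem_tfF 0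
  neg_mem' {P} hP := by
    have := mul_mem_tfF (algebraMap_mem_tfF (-1)) hP
    simpa using this

/-- Evaluation of transfer functions at a point of the unit circle. -/
def tfEvalHom (z : ℂ) (hz : ‖z‖ = 1) : tfRing →+* ℂ where
  toFun P := tfEval P z
  map_one' := RatFunc.eval_one _ _
  map_mul' P Q := RatFunc.eval_mul _ _ (P.2 z hz) (Q.2 z hz)
  map_zero' := RatFunc.eval_zero _ _
  map_add' P Q := RatFunc.eval_add _ _ (P.2 z hz) (Q.2 z hz)

@[simp]
theorem tfEvalHom_apply (z : ℂ) (hz : ‖z‖ = 1) (P : tfRing) :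
    tfEvalHom z hz P = tfEval (P : RatFunc ℝ) z := rfl

/-- The impulse response of an element of the ring of transfer functions. -/
def resp (P : tfRing) : ℤ → ℝ := impulse (P : RatFunc ℝ)

theorem hasSum_resp (P : tfRing) (z : ℂ) (hz : ‖z‖ = 1) :
    HasSum (fun k : ℤ => (resp P k : ℂ) * z ^ (-k)) (tfEvalHom z hz P) :=
  isImpulseResponse_impulse P.2 z hz

theorem summable_norm_resp (P : tfRing) : Summable fun k => ‖resp P k‖ :=
  summable_norm_impulse P.2

theorem resp_eq_of_hasSum {P : tfRing} {p : ℤ → ℝ}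
    (h : ∀ (z : ℂ) (hz : ‖z‖ = 1),
      HasSum (fun k : ℤ => (p k : ℂ) * z ^ (-k)) (tfEvalHom z hz P)) : resp P = p :=
  IsImpulseResponse.impulse_eq P.2 h

theorem resp_add (P Q : tfRing) (k : ℤ) : resp (P + Q) k = resp P k + resp Q k := by
  refine congrFun (resp_eq_of_hasSum (p := fun k => resp P k + resp Q k) fun z hz => ?_) k
  rw [map_add]
  simpa [add_mul] using (hasSum_resp P z hz).add (hasSum_resp Q z hz)

theorem resp_neg (P : tfRing) (k : ℤ) : resp (-P) k = -resp P k := by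
  refine congrFun (resp_eq_of_hasSum (p := fun k => -resp P k) fun z hz => ?_) k
  rw [map_neg]
  simpa using (hasSum_resp P z hz).neg

theorem resp_mul (P Q : tfRing) (n : ℤ) :
    resp (P * Q) n = ∑' k, resp P k * resp Q (n - k) := by
  refine congrFun
    (resp_eq_of_hasSum (p := fun n => ∑' k, resp P k * resp Q (n - k)) fun z hz => ?_) n
  rw [map_mul]
  have h := HasLaurent.mul (isImpulseResponse_impulse P.2).hasLaurent
    (isImpulseResponse_impulse Q.2).hasLaurent z hz
  convert! h using 1
  ext n
  push_cast
  rfl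

/-- The transfer function of a polynomial in the forward shift. -/
def polyTF : Polynomial ℝ →+* tfRing :=
  (algebraMap (Polynomial ℝ) (RatFunc ℝ)).codRestrict tfRing algebraMap_mem_tfF

@[simp]
theorem coe_polyTF (p : Polynomial ℝ) :
    (polyTF p : RatFunc ℝ) = algebraMap (Polynomial ℝ) (RatFunc ℝ) p := rfl

theorem tfEvalHom_polyTF (z : ℂ) (hz : ‖z‖ = 1) (p : Polynomial ℝ) :
    tfEvalHom z hz (polyTF p) = p.eval₂ (algebraMap ℝ ℂ) z := by
  simp [tfEval, RatFunc.eval]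

theorem resp_polyTF_monomial (n : ℕ) (a : ℝ) (k : ℤ) :
    resp (polyTF (Polynomial.monomial n a)) k = if k = -n then a else 0 := by
  refine congrFun (resp_eq_of_hasSum (p := fun k : ℤ => if k = -n then a else 0)
    fun z hz => ?_) k
  rw [tfEvalHom_polyTF]
  have h := hasLaurent_zpow (a : ℂ) (-n) z hz
  convert! h using 1
  · ext k
    split_ifs with hk <;> simp [hk]
  · simp

theorem resp_one (k : ℤ) : resp 1 k = if k = 0 then 1 else 0 := by
  have := resp_polyTF_monomial 0 1 k
  simpa using this

theorem resp_zero (k : ℤ) : resp 0 k = 0 := by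
  have := resp_add 0 0 k
  simpa using this

/-- Expansions are in powers of `z⁻¹`, so `z` is an advance by one step and polynomials are exactly
the responses with finite anticausal support. The Wiener-Hopf argument rests on this. -/
theorem resp_polyTF (p : Polynomial ℝ) (k : ℤ) :
    resp (polyTF p) k = if k ≤ 0 then p.coeff (-k).toNat else 0 := by
  induction p using Polynomial.induction_on' with
  | add p q hp hq =>
    rw [map_add, resp_add, hp, hq]
    split_ifs <;> simp
  | monomial n a =>
    rw [resp_polyTF_monomial, Polynomial.coeff_monomial]
    split_ifs <;> first | rfl | lia

theorem tfEval_eq_div (P : RatFunc ℝ) (z : ℂ) : tfEval P z =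
    P.num.eval₂ (algebraMap ℝ ℂ) z / P.denom.eval₂ (algebraMap ℝ ℂ) z := rfl

/-- The denominator of the inverse divides the numerator of `P`, which has no zero on the circle. -/
theorem isUnit_tfRing {P : tfRing} (h : ∀ (z : ℂ) (hz : ‖z‖ = 1), tfEvalHom z hz P ≠ 0) :
    IsUnit P := by
  have h0 : (P : RatFunc ℝ) ≠ 0 := by
    intro h0
    have : P = 0 := Subtype.ext h0
    exact h 1 (by simp) (by rw [this, map_zero])
  have hinv : (P : RatFunc ℝ)⁻¹ ∈ tfRing :=
    mem_tfF_of_denom_dvd (RatFunc.denom_inv_dvd h0) fun z hz h1 => h z hz (by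
      rw [tfEvalHom_apply, tfEval_eq_div, h1, zero_div])
  exact IsUnit.of_mul_eq_one ⟨_, hinv⟩ (Subtype.ext (mul_inv_cancel₀ h0))

/-- The numerator vanishes on the whole circle, an infinite set. -/
theorem eq_zero_of_resp_eq_zero {P : tfRing} (h : ∀ k, resp P k = 0) : P = 0 := by
  have hev : ∀ z : ℂ, ‖z‖ = 1 → (P : RatFunc ℝ).num.eval₂ (algebraMap ℝ ℂ) z = 0 := by
    intro z hz
    have h1 := hasSum_resp P z hz
    simp only [h, Complex.ofReal_zero, zero_mul] at h1
    have h2 : tfEval (P : RatFunc ℝ) z = 0 := h1.unique hasSum_zero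
    rw [tfEval_eq_div, div_eq_zero_iff] at h2
    exact h2.resolve_right (P.2 z hz)
  have hnum : (P : RatFunc ℝ).num.map (algebraMap ℝ ℂ) = 0 := by
    refine Polynomial.eq_zero_of_infinite_isRoot _ (Set.Infinite.mono (s := {z : ℂ | ‖z‖ = 1})
      (fun z hz => ?_) ?_)
    · rw [Set.mem_ofPred_eq, Polynomial.IsRoot, Polynomial.eval_map]
      exact hev z hz
    · have : Set.Infinite (Metric.sphere (0 : ℂ) 1) := by
        refine (isPreconnected_sphere (by simp [Complex.rank_real_complex]) _
          _).infinite_of_nontrivial ⟨1, by simp, -1, by simp, fun h => ?_⟩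
        have := congrArg Complex.re h
        norm_num at this
      simpa [Metric.sphere, dist_eq_norm] using this
  have : (P : RatFunc ℝ) = 0 :=
    RatFunc.num_eq_zero_iff.1 ((Polynomial.map_eq_zero_iff (algebraMap ℝ ℂ).injective).1 hnum)
  exact Subtype.ext this

/-- Finitely many transfer functions have a common denominator, which is invertible. -/
theorem exists_common_denom {ι : Type*} [Finite ι] (f : ι → tfRing) :
    ∃ D : Polynomial ℝ, IsUnit (polyTF D) ∧ ∀ i, ∃ n : Polynomial ℝ, polyTF D * f i = polyTF n := by
  have := Fintype.ofFinite ι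
  have hden : ∀ P : tfRing, IsUnit (polyTF (P : RatFunc ℝ).denom) := fun P =>
    isUnit_tfRing fun z hz => by
      rw [tfEvalHom_polyTF]
      exact P.2 z hz
  refine ⟨∏ i, (f i : RatFunc ℝ).denom, ?_, fun i => ?_⟩
  · rw [map_prod]
    exact (Submonoid.prod_mem (IsUnit.submonoid tfRing) fun i _ => hden (f i))
  · obtain ⟨g, hg⟩ := Finset.dvd_prod_of_mem (fun i => (f i : RatFunc ℝ).denom) (Finset.mem_univ i)
    refine ⟨g * (f i : RatFunc ℝ).num, Subtype.ext ?_⟩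
    simp only [hg, map_mul, Subring.coe_mul, coe_polyTF]
    have h0 : algebraMap (Polynomial ℝ) (RatFunc ℝ) (f i : RatFunc ℝ).denom ≠ 0 :=
      RatFunc.algebraMap_ne_zero (RatFunc.denom_ne_zero _)
    have h1 := RatFunc.num_div_denom (f i : RatFunc ℝ)
    rw [div_eq_iff h0] at h1
    rw [h1]
    ring

/-- The backward shift. -/
def backShift : tfRing :=
  ⟨RatFunc.X⁻¹, mem_tfF_of_denom_dvd (q := Polynomial.X)
    (by simpa using RatFunc.denom_inv_dvd (K := ℝ) RatFunc.X_ne_zero)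
    fun z hz => by simpa using ne_zero_of_norm_one hz⟩

theorem tfEvalHom_backShift (z : ℂ) (hz : ‖z‖ = 1) : tfEvalHom z hz backShift = z⁻¹ := by
  have h : polyTF Polynomial.X * backShift = 1 := Subtype.ext (by
    simp [backShift, RatFunc.algebraMap_X, RatFunc.X_ne_zero])
  have := congrArg (tfEvalHom z hz) h
  rw [map_mul, tfEvalHom_polyTF, Polynomial.eval₂_X, map_one] at this
  exact eq_inv_of_mul_eq_one_right this

/-- Time reversal: `P(1/z)`. -/
theorem exists_time_reversal (P : tfRing) : ∃ R : tfRing, ∀ k, resp R k = resp P (-k) := by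
  have hev : ∀ (p : Polynomial ℝ) (z : ℂ) (hz : ‖z‖ = 1),
      tfEvalHom z hz (p.eval₂ (polyTF.comp Polynomial.C) backShift) =
        p.eval₂ (algebraMap ℝ ℂ) z⁻¹ := by
    intro p z hz
    rw [Polynomial.hom_eval₂, tfEvalHom_backShift]
    congr 1
    ext x
    simp only [RingHom.comp_apply]
    rw [tfEvalHom_polyTF, Polynomial.eval₂_C]
  have hinv : ∀ {z : ℂ}, ‖z‖ = 1 → ‖z⁻¹‖ = 1 := fun hz => by simp [hz]
  -- Inversion preserves the circle, so the denominator evaluated at `z⁻¹` is a unit, and `P(1/z)`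
  -- is a quotient inside `tfRing`.
  obtain ⟨v, hv⟩ : IsUnit
      ((P : RatFunc ℝ).denom.eval₂ (polyTF.comp Polynomial.C) backShift) :=
    isUnit_tfRing fun z hz => by
      rw [hev]
      exact P.2 _ (hinv hz)
  refine ⟨(P : RatFunc ℝ).num.eval₂ (polyTF.comp Polynomial.C) backShift * ↑v⁻¹, fun k => ?_⟩
  refine congrFun (resp_eq_of_hasSum (p := fun k => resp P (-k)) fun z hz => ?_) k
  have h1 := hasSum_resp P z⁻¹ (hinv hz)
  rw [← (Equiv.neg ℤ).hasSum_iff] at h1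
  convert! h1 using 1
  · ext k
    simp
  · have h2 := congrArg (tfEvalHom z hz) v.mul_inv
    rw [map_mul, hv, hev, map_one] at h2
    rw [map_mul, hev, tfEvalHom_apply (z⁻¹), tfEval_eq_div, div_eq_mul_inv]
    rw [eq_inv_of_mul_eq_one_right h2]

/-- Causal transfer functions form a subring. -/
def causalRing : Subring tfRing where
  carrier := {P | ∀ k < 0, resp P k = 0}
  mul_mem' {P Q} hP hQ k hk := by
    rw [resp_mul]
    refine (tsum_congr fun j => ?_).trans tsum_zero
    rcases lt_or_ge j 0 with hj | hj
    · rw [hP j hj, zero_mul]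
    · rw [hQ (k - j) (by lia), mul_zero]
  one_mem' k hk := by rw [resp_one, if_neg hk.ne]
  add_mem' {P Q} hP hQ k hk := by rw [resp_add, hP k hk, hQ k hk, add_zero]
  zero_mem' k _ := resp_zero k
  neg_mem' {P} hP k hk := by rw [resp_neg, hP k hk, neg_zero]

/-! ### Filters acting on bounded sequences -/

open scoped BoundedContinuousFunction

section Filters

variable {H : Type*} [NormedAddCommGroup H] [NormedSpace ℝ H]

/-- Delay of a bounded sequence by `k` steps. -/
def delay (k : ℤ) : (ℤ →ᵇ H) →L[ℝ] (ℤ →ᵇ H) :=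
  LinearMap.mkContinuous
    { toFun := fun x => x.compContinuous ⟨fun t => t - k, by fun_prop⟩
      map_add' := fun _ _ => rfl
      map_smul' := fun _ _ => rfl } 1
    fun x => by
      rw [one_mul]
      exact (BoundedContinuousFunction.norm_le (norm_nonneg _)).2 fun t => x.norm_coe_le_norm _

@[simp]
theorem delay_apply (k : ℤ) (x : ℤ →ᵇ H) (t : ℤ) : delay k x t = x (t - k) := rfl

theorem norm_delay_le (k : ℤ) : ‖(delay k : (ℤ →ᵇ H) →L[ℝ] (ℤ →ᵇ H))‖ ≤ 1 :=
  LinearMap.mkContinuous_norm_le _ zero_le_one _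

theorem delay_add (a b : ℤ) :
    (delay (a + b) : (ℤ →ᵇ H) →L[ℝ] (ℤ →ᵇ H)) = delay a * delay b := by
  ext x t
  simp [sub_sub]

variable [CompleteSpace H]

theorem summable_resp_smul_delay (P : tfRing) :
    Summable fun k => resp P k • (delay k : (ℤ →ᵇ H) →L[ℝ] (ℤ →ᵇ H)) :=
  (summable_norm_smul_of_le_one norm_delay_le (summable_norm_resp P)).of_norm

variable (H) in
/-- Transfer functions as convolution operators on bounded sequences. -/
def convHom : tfRing →+* ((ℤ →ᵇ H) →L[ℝ] (ℤ →ᵇ H)) where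
  toFun P := ∑' k, resp P k • delay k
  map_one' := by
    rw [tsum_eq_single 0 fun k hk => by rw [resp_one, if_neg hk, zero_smul]]
    rw [resp_one, if_pos rfl, one_smul]
    ext x t
    simp
  map_zero' := by simp [resp_zero]
  map_add' P Q := by
    simp only [resp_add, add_smul]
    exact (summable_resp_smul_delay P).tsum_add (summable_resp_smul_delay Q)
  map_mul' P Q := by
    simp only [resp_mul]
    exact (hasSum_conv_smul (B := (ℤ →ᵇ H) →L[ℝ] (ℤ →ᵇ H)) (S := delay) delay_add
      norm_delay_le (summable_norm_resp P)
      (summable_norm_resp Q)).tsum_eq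

/-- This action makes linear algebra over the commutative ring `tfRing`, or over a subring,
applicable to processes: spans are the sets of filtered processes. -/
instance : Module tfRing (ℤ →ᵇ H) := Module.compHom _ (convHom H)

theorem tf_smul_def (P : tfRing) (x : ℤ →ᵇ H) : P • x = convHom H P x := rfl

theorem hasSum_tf_smul_apply (P : tfRing) (x : ℤ →ᵇ H) (t : ℤ) :
    HasSum (fun k => resp P k • x (t - k)) ((P • x) t) := by
  have h : HasSum (fun k => resp P k • delay k) (convHom H P) :=
    (summable_resp_smul_delay P).hasSum
  have h1 := h.mapL (ContinuousLinearMap.apply ℝ (ℤ →ᵇ H) x)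
  have h2 := h1.mapL (BoundedContinuousFunction.evalCLM ℝ t)
  exact h2

theorem tf_smul_apply (P : tfRing) (x : ℤ →ᵇ H) (t : ℤ) :
    (P • x) t = ∑' k, resp P k • x (t - k) :=
  (hasSum_tf_smul_apply P x t).tsum_eq.symm

theorem hasSum_tf_smul_apply' (P : tfRing) (x : ℤ →ᵇ H) (t : ℤ) :
    HasSum (fun k => resp P (t - k) • x k) ((P • x) t) := by
  have := hasSum_tf_smul_apply P x t
  rw [← (Equiv.subLeft t).hasSum_iff] at this
  simpa [Function.comp_def] using this

theorem tf_smul_delay (P : tfRing) (k : ℤ) (x : ℤ →ᵇ H) : P • delay k x = delay k (P • x) := by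
  ext t
  rw [delay_apply, tf_smul_apply, tf_smul_apply]
  simp only [delay_apply, sub_right_comm]

end Filters

/-- The unit impulse. -/
def unitImpulse : ℤ →ᵇ ℝ :=
  BoundedContinuousFunction.ofNormedAddCommGroupDiscrete (fun k => if k = 0 then 1 else 0) 1
    fun k => by split_ifs <;> simp

theorem unitImpulse_apply (k : ℤ) : unitImpulse k = if k = 0 then 1 else 0 := rfl

theorem tf_smul_unitImpulse (P : tfRing) (k : ℤ) : (P • unitImpulse) k = resp P k := by
  rw [tf_smul_apply, tsum_eq_single k]
  · simp [unitImpulse_apply]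
  · intro j hj
    rw [unitImpulse_apply, if_neg (by lia), smul_zero]

/-- Polynomials in the forward shift preserve sequences that vanish on nonnegative times. -/
theorem polyTF_smul_apply_eq_zero (p : Polynomial ℝ) {x : ℤ →ᵇ ℝ} {n : ℤ}
    (hx : ∀ k, n ≤ k → x k = 0) {k : ℤ} (hk : n ≤ k) : (polyTF p • x) k = 0 := by
  rw [tf_smul_apply]
  refine (tsum_congr fun j => ?_).trans tsum_zero
  rw [resp_polyTF]
  split_ifs with hj
  · rw [hx _ (by lia), smul_zero]
  · rw [zero_smul]

/-- A polynomial advances a sequence by at most its degree. -/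
theorem polyTF_smul_apply_eq_zero_of_lt (p : Polynomial ℝ) {x : ℤ →ᵇ ℝ}
    (hx : ∀ k < 0, x k = 0) {k : ℤ} (hk : k < -p.natDegree) : (polyTF p • x) k = 0 := by
  rw [tf_smul_apply]
  refine (tsum_congr fun j => ?_).trans tsum_zero
  rw [resp_polyTF]
  split_ifs with hj
  · rcases lt_or_ge (k - j) 0 with h | h
    · rw [hx _ h, smul_zero]
    · rw [Polynomial.coeff_eq_zero_of_natDegree_lt (by lia), zero_smul]
  · rw [zero_smul]

/-- A sequence supported on finitely many nonpositive times is a polynomial in the forward shift,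
applied to the unit impulse. -/
theorem exists_polyTF_smul_unitImpulse {x : ℤ →ᵇ ℝ} {n : ℕ} (h1 : ∀ k, 1 ≤ k → x k = 0)
    (h2 : ∀ k : ℤ, k < -n → x k = 0) : ∃ p : Polynomial ℝ, x = polyTF p • unitImpulse := by
  refine ⟨∑ i ∈ Finset.range (n + 1), Polynomial.monomial i (x (-i)), ?_⟩
  ext k
  rw [tf_smul_unitImpulse, resp_polyTF]
  split_ifs with hk
  · rw [Polynomial.finsetSum_coeff]
    simp only [Polynomial.coeff_monomial, Finset.sum_ite_eq', Finset.mem_range]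
    split_ifs with hn
    · congr 1
      lia
    · exact h2 _ (by lia)
  · exact h1 _ (by lia)

/-! ### From d-separation to a separating partition -/

section DSeparation

variable {V : Type*}

/-- `v` has a descendant in `Z`. -/
def IsAncestorOf (G : Digraph V) (Z : Finset V) (v : V) : Prop := ∃ w ∈ Z, IsDescendant G v w

theorem IsAncestorOf.of_mem {G : Digraph V} {Z : Finset V} {v : V} (h : v ∈ Z) :
    IsAncestorOf G Z v := ⟨v, h, Relation.ReflTransGen.refl⟩

theorem IsAncestorOf.of_descendant {G : Digraph V} {Z : Finset V} {v w : V}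
    (h : IsDescendant G v w) : IsAncestorOf G Z w → IsAncestorOf G Z v
  | ⟨x, hx, hwx⟩ => ⟨x, hx, h.trans hwx⟩

/-- Walks whose interior nodes do not block: colliders have a descendant in `Z`, the other
interior nodes are not in `Z`. -/
structure IsActiveWalk (G : Digraph V) (Z : Finset V) (n : ℕ) (node : ℕ → V) (right : ℕ → Bool) :
    Prop where
  adj_right : ∀ p < n, right p = true → G.Adj (node p) (node (p + 1))
  adj_left : ∀ p < n, right p = false → G.Adj (node (p + 1)) (node p)
  collider : ∀ p, p + 1 < n → right p = true → right (p + 1) = false →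
    IsAncestorOf G Z (node (p + 1))
  noncollider : ∀ p, p + 1 < n → ¬ (right p = true ∧ right (p + 1) = false) → node (p + 1) ∉ Z

namespace IsActiveWalk

variable {G : Digraph V} {Z : Finset V} {n : ℕ} {node : ℕ → V} {right : ℕ → Bool}

/-- The old endpoint becomes an interior node only if the walk is nonempty; the premises `n = k + 1`
leave the start of the empty walk free. -/
theorem extend (h : IsActiveWalk G Z n node right) (w : V) (r : Bool)
    (h1 : r = true → G.Adj (node n) w) (h2 : r = false → G.Adj w (node n))
    (h3 : ∀ k, n = k + 1 → right k = true → r = false → IsAncestorOf G Z (node n))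
    (h4 : ∀ k, n = k + 1 → ¬ (right k = true ∧ r = false) → node n ∉ Z) :
    IsActiveWalk G Z (n + 1) (fun p => if p ≤ n then node p else w)
      (fun p => if p < n then right p else r) := by
  constructor
  · intro p hp hr
    rcases Nat.lt_succ_iff_lt_or_eq.1 hp with hp | rfl
    · simp only [hp, hp.le, Nat.succ_le_of_lt hp, if_true] at hr ⊢
      exact h.adj_right p hp hr
    · simp at hr ⊢
      exact h1 hr
  · intro p hp hr
    rcases Nat.lt_succ_iff_lt_or_eq.1 hp with hp | rfl
    · simp only [hp, hp.le, Nat.succ_le_of_lt hp, if_true] at hr ⊢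
      exact h.adj_left p hp hr
    · simp at hr ⊢
      exact h2 hr
  · intro p hp hr hr'
    rcases Nat.lt_succ_iff_lt_or_eq.1 hp with hp | rfl
    · have : p < n := by lia
      simp only [hp, hp.le, this, if_true] at hr hr' ⊢
      exact h.collider p hp hr hr'
    · simp at hr hr' ⊢
      exact h3 p rfl hr hr'
  · intro p hp hr
    rcases Nat.lt_succ_iff_lt_or_eq.1 hp with hp | rfl
    · have : p < n := by lia
      simp only [hp, hp.le, this, if_true] at hr ⊢
      exact h.noncollider p hp hr
    · simp only [Nat.lt_succ_self, lt_irrefl, if_true, if_false, le_refl] at hr ⊢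
      exact h4 p rfl hr

/-- Either the arrows keep pointing forward and form a directed chain, or the first reversal is an
active collider, whose descendant in `Z` is also one of the starting node. -/
theorem directed_or_ancestor (h : IsActiveWalk G Z n node right) {p : ℕ} (hp : right p = true)
    {q : ℕ} (hpq : p ≤ q) (hq : q < n) : IsAncestorOf G Z (node p) ∨
      (right q = true ∧ IsDescendant G (node p) (node (q + 1))) := by
  induction q, hpq using Nat.le_induction with
  | base => exact Or.inr ⟨hp, Relation.ReflTransGen.single (h.adj_right p hq hp)⟩
  | succ q hpq ih =>
    rcases ih (by lia) with ih | ⟨ih1, ih2⟩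
    · exact Or.inl ih
    · cases hr : right (q + 1) with
      | true => exact Or.inr ⟨rfl, ih2.tail (h.adj_right _ hq hr)⟩
      | false => exact Or.inl ((h.collider q hq ih1 hr).of_descendant ih2)

/-- Removing the closed part of a walk between two visits of the same node. -/
theorem shortcut (h : IsActiveWalk G Z n node right) {p k : ℕ} (hk : 0 < k) (hpk : p + k ≤ n)
    (heq : node p = node (p + k)) :
    IsActiveWalk G Z (n - k) (fun m => if m ≤ p then node m else node (m + k))
      (fun m => if m < p then right m else right (m + k)) := by
  constructor
  · intro m hm hr
    rcases lt_trichotomy m p with hmp | rfl | hmp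
    · simp only [hmp, hmp.le, Nat.succ_le_of_lt hmp, if_true] at hr ⊢
      exact h.adj_right m (by lia) hr
    · simp at hr ⊢
      rw [heq, add_right_comm]
      exact h.adj_right _ (by lia) hr
    · have h1 : ¬ m < p := by lia
      have h2 : ¬ m ≤ p := by lia
      have h3 : ¬ m + 1 ≤ p := by lia
      simp only [h1, h2, h3, if_false] at hr ⊢
      rw [add_right_comm]
      exact h.adj_right _ (by lia) hr
  · intro m hm hr
    rcases lt_trichotomy m p with hmp | rfl | hmp
    · simp only [hmp, hmp.le, Nat.succ_le_of_lt hmp, if_true] at hr ⊢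
      exact h.adj_left m (by lia) hr
    · simp at hr ⊢
      rw [heq, add_right_comm]
      exact h.adj_left _ (by lia) hr
    · have h1 : ¬ m < p := by lia
      have h2 : ¬ m ≤ p := by lia
      have h3 : ¬ m + 1 ≤ p := by lia
      simp only [h1, h2, h3, if_false] at hr ⊢
      rw [add_right_comm]
      exact h.adj_left _ (by lia) hr
  · intro m hm hr hr'
    rcases lt_trichotomy (m + 1) p with hmp | rfl | hmp
    · have h1 : m < p := by lia
      simp only [hmp, hmp.le, h1, if_true] at hr hr' ⊢
      exact h.collider m (by lia) hr hr'
    · simp at hr hr' ⊢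
      obtain ⟨q, rfl⟩ : ∃ q, k = q + 1 := ⟨k - 1, by lia⟩
      -- The junction has become a collider. If the first visit was left against the arrow, it was a
      -- collider already. Otherwise the removed part either yields a descendant in `Z` or returns
      -- along a forward arrow, and then the last visit was a collider.
      cases hp : right (m + 1) with
      | false => exact h.collider m (by lia) hr hp
      | true =>
        rcases h.directed_or_ancestor hp (q := m + 1 + q) (by lia) (by lia) with h1 | ⟨h1, -⟩
        · exact h1
        · rw [heq]
          exact h.collider (m + 1 + q) (by lia) h1 hr'
    · have h1 : ¬ m < p := by lia
      have h2 : ¬ m + 1 < p := by lia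
      have h3 : ¬ m + 1 ≤ p := by lia
      simp only [h1, h2, h3, if_false] at hr hr' ⊢
      rw [add_right_comm] at hr' ⊢
      exact h.collider _ (by lia) hr hr'
  · intro m hm hr
    rcases lt_trichotomy (m + 1) p with hmp | rfl | hmp
    · have h1 : m < p := by lia
      simp only [hmp, hmp.le, h1, if_true] at hr ⊢
      exact h.noncollider m (by lia) hr
    · simp only [Nat.lt_succ_self, lt_irrefl, if_true, if_false, le_refl] at hr ⊢
      obtain ⟨q, rfl⟩ : ∃ q, k = q + 1 := ⟨k - 1, by lia⟩
      -- If the junction were in `Z`, both visits would be colliders; the arrow into the first and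
      -- the arrow out of the last then make the junction a collider too.
      intro hZ
      have h1 := mt (h.noncollider m (by lia)) (not_not.2 hZ)
      rw [heq] at hZ
      have h2 := mt (h.noncollider (m + 1 + q) (by lia)) (not_not.2 hZ)
      exact hr ⟨(not_not.1 h1).1, (not_not.1 h2).2⟩
    · have h1 : ¬ m < p := by lia
      have h2 : ¬ m + 1 < p := by lia
      have h3 : ¬ m + 1 ≤ p := by lia
      simp only [h1, h2, h3, if_false] at hr ⊢
      rw [add_right_comm] at hr ⊢
      exact h.noncollider _ (by lia) hr

end IsActiveWalk

/-- An active walk between nodes outside `Z` contains an active path. -/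
theorem exists_not_blocked_of_isActiveWalk {G : Digraph V} {Z : Finset V} {i j : V} (hi : i ∉ Z)
    (hj : j ∉ Z) (h : ∃ n node right, IsActiveWalk G Z n node right ∧ node 0 = i ∧ node n = j) :
    ∃ π : DiPath G i j, ¬ π.Blocked Z := by
  classical
  -- By `shortcut`, an active walk of minimal length repeats no node, which is more than a path
  -- requires.
  obtain ⟨node, right, hw, h0, hn⟩ := Nat.find_spec h
  set n := Nat.find h with hn_def
  have hinj : ∀ p q, p < q → q ≤ n → node p ≠ node q := by
    intro p q hpq hq heq
    obtain ⟨k, rfl⟩ : ∃ k, q = p + k := ⟨q - p, by lia⟩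
    refine Nat.find_min h (m := n - k) (by lia)
      ⟨_, _, hw.shortcut (p := p) (k := k) (by lia) hq heq, by simpa using h0, ?_⟩
    rcases eq_or_lt_of_le hq with hq' | hq'
    · have : n - k = p := by lia
      simp only [this, le_refl, if_true]
      rw [heq, hq', hn]
    · have h1 : ¬ n - k ≤ p := by lia
      have h2 : n - k + k = n := by lia
      simp only [h1, if_false, h2, hn]
  refine ⟨⟨n, node, right, h0, hn, hw.adj_right, hw.adj_left, fun p q hpq hq heq =>
    hinj p q hpq hq.le (Prod.ext_iff.1 heq).1⟩, ?_⟩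
  rintro (⟨p, hp, hpZ, hc⟩ | ⟨p, ⟨hp0, hpn, hr, hr'⟩, hd⟩)
  -- Endpoints are never colliders, so they would block if they were in `Z`; this is the role of
  -- `hi` and `hj`.
  · simp only [DiPath.IsCollider] at hp hpZ hc
    rcases Nat.eq_zero_or_pos p with rfl | hp0
    · exact hi (h0 ▸ hpZ)
    rcases eq_or_lt_of_le hp with rfl | hpn
    · exact hj (hn ▸ hpZ)
    obtain ⟨m, rfl⟩ : ∃ m, p = m + 1 := ⟨p - 1, by lia⟩
    exact hw.noncollider m hpn (fun hm => hc ⟨hp0, hpn, hm⟩) hpZ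
  · simp only at hpn hr hr' hd
    obtain ⟨m, rfl⟩ : ∃ m, p = m + 1 := ⟨p - 1, by lia⟩
    obtain ⟨w, hwZ, hw'⟩ := hw.collider m hpn hr hr'
    exact hd w hw' hwZ

/-- Nodes that can be reached from `I` along active walks; the flag tells whether the last arrow
points to the node. -/
inductive ActiveReach (G : Digraph V) (I Z : Finset V) : V → Bool → Prop
  | start {i : V} : i ∈ I → ActiveReach G I Z i false
  | right {v w : V} {b : Bool} : ActiveReach G I Z v b → v ∉ Z → G.Adj v w →
      ActiveReach G I Z w true
  | left {v w : V} : ActiveReach G I Z v false → v ∉ Z → G.Adj w v → ActiveReach G I Z w false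
  | collide {v w : V} : ActiveReach G I Z v true → IsAncestorOf G Z v → G.Adj w v →
      ActiveReach G I Z w false

/-- The last clause is vacuous for the empty walk: the flag `false` of a starting node is a
convention allowing departure in both directions, as from a non-collider. -/
theorem ActiveReach.exists_walk {G : Digraph V} {I Z : Finset V} {v : V} {b : Bool}
    (h : ActiveReach G I Z v b) : ∃ n node right, IsActiveWalk G Z n node right ∧ node 0 ∈ I ∧
      node n = v ∧ ∀ k, n = k + 1 → right k = b := by
  induction h with
  | @start i hi =>
    refine ⟨0, fun _ => i, fun _ => false, ⟨?_, ?_, ?_, ?_⟩, hi, rfl, ?_⟩ <;> intros <;> lia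
  | @right v w b _ hv hvw ih =>
    obtain ⟨n, node, right, hw, h0, rfl, hb⟩ := ih
    exact ⟨n + 1, _, _, hw.extend w true (fun _ => hvw) (by simp) (by simp) (fun _ _ _ => hv),
      by simpa using h0, by simp, fun k hk => by simp [show k = n by lia]⟩
  | @left v w _ hv hvw ih =>
    obtain ⟨n, node, right, hw, h0, rfl, hb⟩ := ih
    exact ⟨n + 1, _, _, hw.extend w false (by simp) (fun _ => hvw)
      (fun k hk hr => by simp [hb k hk] at hr) (fun _ _ _ => hv),
      by simpa using h0, by simp, fun k hk => by simp [show k = n by lia]⟩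
  | @collide v w _ hv hvw ih =>
    obtain ⟨n, node, right, hw, h0, rfl, hb⟩ := ih
    exact ⟨n + 1, _, _, hw.extend w false (by simp) (fun _ => hvw)
      (fun _ _ _ _ => hv) (fun k hk hr => by simp [hb k hk] at hr),
      by simpa using h0, by simp, fun k hk => by simp [show k = n by lia]⟩

theorem DSep.not_activeReach {G : Digraph V} {I Z J : Finset V} (h : DSep G I Z J)
    (hIZ : Disjoint I Z) (hZJ : Disjoint Z J) {j : V} (hj : j ∈ J) (b : Bool) :
    ¬ ActiveReach G I Z j b := by
  intro hr
  obtain ⟨n, node, right, hw, h0, hn, -⟩ := hr.exists_walk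
  obtain ⟨π, hπ⟩ := exists_not_blocked_of_isActiveWalk (Finset.disjoint_left.1 hIZ h0)
    (Finset.disjoint_right.1 hZJ hj) ⟨n, node, right, hw, rfl, hn⟩
  exact hπ (h _ h0 _ hj π)

/-- The chain is traversed backwards from `i`. Its nodes are descendants of `v`, so none of them is
in `Z`. -/
theorem ActiveReach.of_directed_to {G : Digraph V} {I Z : Finset V} {v i : V} (hi : i ∈ I)
    (h : IsDescendant G v i) (hv : ¬ IsAncestorOf G Z v) : ActiveReach G I Z v false := by
  induction h using Relation.ReflTransGen.head_induction_on with
  | refl => exact .start hi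
  | @head v w hvw _ ih =>
    have hw : ¬ IsAncestorOf G Z w :=
      fun h => hv (h.of_descendant (Relation.ReflTransGen.single hvw))
    exact .left (ih hw) (fun h => hw (.of_mem h)) hvw

theorem ActiveReach.of_directed_from {G : Digraph V} {I Z : Finset V} {v w : V} {b : Bool}
    (hr : ActiveReach G I Z v b) (h : IsDescendant G v w) (hv : ¬ IsAncestorOf G Z v) :
    ∃ b', ActiveReach G I Z w b' := by
  induction h with
  | refl => exact ⟨b, hr⟩
  | @tail x w hvx hxw ih =>
    obtain ⟨b', hb'⟩ := ih
    exact ⟨true, .right hb' (fun h => hv ((IsAncestorOf.of_mem h).of_descendant hvx)) hxw⟩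

/-- d-separation splits the ancestors of `I ∪ Z ∪ J` outside `Z` in two parts, `K` and its
complement, which are not joined by an edge and have no common child in `Z`. -/
theorem DSep.exists_partition [Fintype V] [DecidableEq V] {G : Digraph V} {I Z J : Finset V}
    (h : DSep G I Z J) (hIZ : Disjoint I Z) (hZJ : Disjoint Z J) :
    ∃ A K : Finset V, (∀ v w, w ∈ A → G.Adj v w → v ∈ A) ∧ Z ⊆ A ∧ J ⊆ A ∧ K ⊆ A ∧ I ⊆ K ∧
      Disjoint K Z ∧ Disjoint K J ∧
      (∀ v ∈ K, ∀ w ∈ (A \ Z) \ K, ¬ G.Adj v w ∧ ¬ G.Adj w v) ∧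
      (∀ z ∈ Z, ∀ v ∈ K, ∀ w ∈ (A \ Z) \ K, ¬ (G.Adj v z ∧ G.Adj w z)) := by
  classical
  set A : Finset V := Finset.univ.filter (IsAncestorOf G (I ∪ Z ∪ J)) with hA
  have memA : ∀ v, v ∈ A ↔ IsAncestorOf G (I ∪ Z ∪ J) v := fun v => by simp [hA]
  set K : Finset V := A.filter fun v => v ∉ Z ∧ ∃ b, ActiveReach G I Z v b with hK
  have memK : ∀ v, v ∈ K ↔ v ∈ A ∧ v ∉ Z ∧ ∃ b, ActiveReach G I Z v b := fun v => by simp [hK]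
  have hsub : ∀ v ∈ I ∪ Z ∪ J, v ∈ A := fun v hv => (memA v).2 (.of_mem hv)
  have memJ : ∀ w ∈ (A \ Z) \ K, ∀ b, ¬ ActiveReach G I Z w b := by
    intro w hw b hb
    simp only [Finset.mem_sdiff] at hw
    exact hw.2 ((memK w).2 ⟨hw.1.1, hw.1.2, b, hb⟩)
  refine ⟨A, K, ?_, fun v hv => hsub v (by simp [hv]), fun v hv => hsub v (by simp [hv]),
    fun v hv => ((memK v).1 hv).1, ?_, ?_, ?_, ?_, ?_⟩
  · intro v w hw hvw
    exact (memA v).2 (((memA w).1 hw).of_descendant (Relation.ReflTransGen.single hvw))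
  · intro v hv
    exact (memK v).2 ⟨hsub v (by simp [hv]), Finset.disjoint_left.1 hIZ hv, false, .start hv⟩
  · exact Finset.disjoint_left.2 fun v hv => ((memK v).1 hv).2.1
  · refine Finset.disjoint_left.2 fun v hv hvJ => ?_
    obtain ⟨b, hb⟩ := ((memK v).1 hv).2.2
    exact h.not_activeReach hIZ hZJ hvJ b hb
  · intro v hv w hw
    obtain ⟨hvA, hvZ, b, hb⟩ := (memK v).1 hv
    refine ⟨fun hvw => memJ w hw _ (.right hb hvZ hvw), fun hwv => ?_⟩
    -- As `w` is not reached, `v` is reached only with flag `true` and has no descendant in `Z`.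
    -- Being in `A`, it has a descendant in `I` or `J`. From `I` one walks back to `v` and gets the
    -- flag `false`; towards `J` one walks forward and contradicts d-separation.
    have hfalse : ¬ ActiveReach G I Z v false := fun hr => memJ w hw _ (.left hr hvZ hwv)
    cases b with
    | false => exact hfalse hb
    | true =>
      have hanc : ¬ IsAncestorOf G Z v := fun ha => memJ w hw _ (.collide hb ha hwv)
      obtain ⟨x, hx, hvx⟩ := (memA v).1 hvA
      simp only [Finset.mem_union] at hx
      rcases hx with (hx | hx) | hx
      · exact hfalse (.of_directed_to hx hvx hanc)
      · exact hanc ⟨x, hx, hvx⟩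
      · obtain ⟨b', hb'⟩ := hb.of_directed_from hvx hanc
        exact h.not_activeReach hIZ hZJ hx b' hb'
  · rintro z hz v hv w hw ⟨hvz, hwz⟩
    obtain ⟨hvA, hvZ, b, hb⟩ := (memK v).1 hv
    exact memJ w hw _ (.collide (.right hb hvZ hvz) (.of_mem hz) hwz)

/-- d-separation splits the ancestors of `I ∪ Z ∪ J` in two sides `K ∪ ZK` and `K' ∪ ZK'`, with
`Z = ZK ∪ ZK'`, such that the parents of each side are in `Z` or on the same side. -/
theorem DSep.exists_sides [Fintype V] [DecidableEq V] {G : Digraph V} {I Z J : Finset V}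
    (h : DSep G I Z J) (hIZ : Disjoint I Z) (hZJ : Disjoint Z J) :
    ∃ K K' ZK ZK' : Finset V, ZK ∪ ZK' = Z ∧ Disjoint K K' ∧ Disjoint K Z ∧ Disjoint K' Z ∧
      Disjoint ZK ZK' ∧ I ⊆ K ∧ J ⊆ K' ∧
      (∀ c ∈ K ∪ ZK, ∀ b, b ∉ K → b ∉ Z → ¬ G.Adj b c) ∧
      (∀ c ∈ K' ∪ ZK', ∀ b, b ∉ K' → b ∉ Z → ¬ G.Adj b c) := by
  classical
  obtain ⟨A, K, hA, hZA, hJA, hKA, hIK, hKZ, hKJ, hedge, hchild⟩ := h.exists_partition hIZ hZJ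
  set K' := (A \ Z) \ K with hK'
  -- A node of `Z` outside `ZK` has a parent in `K'`, hence none in `K`, as common children in `Z`
  -- are excluded.
  set ZK := Z.filter fun z => ∀ w ∈ K', ¬ G.Adj w z with hZK
  have memK' : ∀ v ∈ A, v ∉ Z → v ∉ K → v ∈ K' := fun v h1 h2 h3 => by simp [hK', h1, h2, h3]
  have memA : ∀ v ∈ K', v ∈ A ∧ v ∉ Z ∧ v ∉ K := fun v hv => by
    simp only [hK', Finset.mem_sdiff] at hv
    exact ⟨hv.1.1, hv.1.2, hv.2⟩
  refine ⟨K, K', ZK, Z \ ZK, Finset.union_sdiff_of_subset (Finset.filter_subset _ _),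
    Finset.disjoint_right.2 fun v hv => (memA v hv).2.2, hKZ,
    Finset.disjoint_left.2 fun v hv => (memA v hv).2.1, Finset.disjoint_sdiff, hIK,
    fun v hv => memK' v (hJA hv) (Finset.disjoint_right.1 hZJ hv)
      (Finset.disjoint_right.1 hKJ hv), fun c hc b hbK hbZ hadj => ?_,
    fun c hc b hbK' hbZ hadj => ?_⟩
  · have hb : c ∈ A → b ∈ K' := fun h => memK' _ (hA _ _ h hadj) hbZ hbK
    rcases Finset.mem_union.1 hc with hc | hc
    · exact (hedge _ hc _ (hb (hKA hc))).2 hadj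
    · have hc' := Finset.mem_filter.1 hc
      exact hc'.2 _ (hb (hZA hc'.1)) hadj
  · have hb : c ∈ A → b ∈ K := fun h => by
      by_contra hbK
      exact hbK' (memK' _ (hA _ _ h hadj) hbZ hbK)
    rcases Finset.mem_union.1 hc with hc | hc
    · exact (hedge _ (hb (memA c hc).1) _ hc).1 hadj
    · have hc' := Finset.mem_sdiff.1 hc
      have hpar : ¬ ∀ w ∈ K', ¬ G.Adj w c := fun h => hc'.2 (Finset.mem_filter.2 ⟨hc'.1, h⟩)
      push Not at hpar
      obtain ⟨w, hw, hadj'⟩ := hpar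
      exact hchild _ hc'.1 _ (hb (hZA hc'.1)) w hw ⟨hadj, hadj'⟩

end DSeparation

/-! ### Linear equations along a separating partition -/

section LinearEquations

variable {C T M : Type*} [Fintype C] [DecidableEq C] [CommRing T] [AddCommGroup M] [Module T M]

/-- `N` inverts the block of `1 - Q` with indices in `S` and vanishes outside of this block. -/
structure IsBlockInverse (Q N : Matrix C C T) (S : Finset C) : Prop where
  left_zero : ∀ a b, a ∉ S → N a b = 0
  right_zero : ∀ a b, b ∉ S → N a b = 0
  mul_right : ∀ a ∈ S, ∀ b ∈ S, ((1 - Q) * N) a b = (1 : Matrix C C T) a b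
  mul_left : ∀ a ∈ S, ∀ b ∈ S, (N * (1 - Q)) a b = (1 : Matrix C C T) a b

theorem sub_sum_smul_eq (Q : Matrix C C T) (x : C → M) (c : C) :
    x c - ∑ b, Q c b • x b = ∑ b, (1 - Q) c b • x b := by
  simp [Matrix.sub_apply, sub_smul, Finset.sum_sub_distrib, Matrix.one_apply, ite_smul]

namespace IsBlockInverse

variable {Q N : Matrix C C T} {S : Finset C}

/-- The left inverse at work. The support condition on `x` is needed because the columns of `N * (1
- Q)` outside `S` are not controlled. -/
theorem sum_smul_sub (h : IsBlockInverse Q N S) {x : C → M} (hx : ∀ b, b ∉ S → x b = 0) {c : C}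
    (hc : c ∈ S) : ∑ a, N c a • (x a - ∑ b, Q a b • x b) = x c := by
  simp only [sub_sum_smul_eq, Finset.smul_sum, smul_smul]
  rw [Finset.sum_comm]
  simp only [← Finset.sum_smul, ← Matrix.mul_apply]
  rw [Finset.sum_eq_single c]
  · rw [h.mul_left c hc c hc, Matrix.one_apply_eq, one_smul]
  · intro b _ hb
    by_cases hbS : b ∈ S
    · rw [h.mul_left c hc b hbS, Matrix.one_apply_ne hb.symm, zero_smul]
    · rw [hx b hbS, smul_zero]
  · simp

/-- The right inverse at work. Here `f` may be arbitrary, since the columns of `N` outside `S`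
vanish. -/
theorem sub_sum_smul (h : IsBlockInverse Q N S) (f : C → M) {c : C} (hc : c ∈ S) :
    (∑ a, N c a • f a) - ∑ b, Q c b • ∑ a, N b a • f a = f c := by
  rw [sub_sum_smul_eq Q (fun b => ∑ a, N b a • f a) c]
  simp only [Finset.smul_sum, smul_smul]
  rw [Finset.sum_comm]
  simp only [← Finset.sum_smul, ← Matrix.mul_apply]
  rw [Finset.sum_eq_single c]
  · rw [h.mul_right c hc c hc, Matrix.one_apply_eq, one_smul]
  · intro b _ hb
    by_cases hbS : b ∈ S
    · rw [h.mul_right c hc b hbS, Matrix.one_apply_ne hb.symm, zero_smul]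
    · simp [Matrix.mul_apply, h.right_zero _ b hbS]
  · simp

theorem sum_smul_mem (h : IsBlockInverse Q N S) (f : C → M) (c : C) :
    ∑ a, N c a • f a ∈ Submodule.span T (f '' S) := by
  refine Submodule.sum_mem _ fun a _ => ?_
  by_cases ha : a ∈ S
  · exact Submodule.smul_mem _ _ (Submodule.subset_span ⟨a, ha, rfl⟩)
  · rw [h.right_zero c a ha, zero_smul]
    exact Submodule.zero_mem _

/-- If the parents of the block `S` outside of `S` are in `Z`, then the block is determined by
`Z` and by its own inputs. -/
theorem sub_sum_smul_mem (h : IsBlockInverse Q N S) {y e : C → M}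
    (hy : ∀ c, y c = ∑ b, Q c b • y b + e c) {Z : Finset C}
    (hQ : ∀ c ∈ S, ∀ b, b ∉ S → b ∉ Z → Q c b = 0) {c : C} (hc : c ∈ S) :
    y c - ∑ a, N c a • e a ∈ Submodule.span T (y '' Z) := by
  -- Cutting `y` off outside `S` changes the equations in `S` only by the terms of parents outside
  -- `S`, and these lie in `Z`.
  set x : C → M := fun b => if b ∈ S then y b else 0 with hx
  have h1 := h.sum_smul_sub (x := x) (fun b hb => by simp [hx, hb]) hc
  have h2 : y c = x c := by simp [hx, hc]
  rw [h2, ← h1, ← Finset.sum_sub_distrib]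
  refine Submodule.sum_mem _ fun a _ => ?_
  rw [← smul_sub]
  by_cases ha : a ∈ S
  · refine Submodule.smul_mem _ _ ?_
    have h3 : x a - ∑ b, Q a b • x b - e a = ∑ b, Q a b • (y b - x b) := by
      simp only [smul_sub, Finset.sum_sub_distrib]
      have : x a = y a := by simp [hx, ha]
      rw [this, hy a]
      abel
    rw [h3]
    refine Submodule.sum_mem _ fun b _ => ?_
    by_cases hbS : b ∈ S
    · simp [hx, hbS]
    by_cases hbZ : b ∈ Z
    · have : x b = 0 := by simp [hx, hbS]
      rw [this, sub_zero]
      exact Submodule.smul_mem _ _ (Submodule.subset_span ⟨b, hbZ, rfl⟩)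
    · rw [hQ a ha b hbS hbZ, zero_smul]
      exact Submodule.zero_mem _
  · rw [h.right_zero c a ha, zero_smul]
    exact Submodule.zero_mem _

end IsBlockInverse

/-- The signals of a network which is split by `Z` in two parts `K` and `J`: an estimate from the
signals of `K` and `Z` is the sum of an estimate from `Z` whose error depends only on the inputs
on the side of `J`, and a combination of the inputs on the side of `K`. -/
theorem exists_estimate_of_partition {Q NK NJ NA : Matrix C C T} {K J ZK ZJ : Finset C}
    (hKJ : Disjoint K J) (hKZ : Disjoint K (ZK ∪ ZJ)) (hJZ : Disjoint J (ZK ∪ ZJ))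
    (hNK : IsBlockInverse Q NK K) (hNJ : IsBlockInverse Q NJ J)
    (hNA : IsBlockInverse Q NA (K ∪ J ∪ (ZK ∪ ZJ)))
    (hQK : ∀ c ∈ K ∪ ZK, ∀ b, b ∉ K → b ∉ ZK ∪ ZJ → Q c b = 0)
    (hQJ : ∀ c ∈ J ∪ ZJ, ∀ b, b ∉ J → b ∉ ZK ∪ ZJ → Q c b = 0)
    {y e : C → M} (hy : ∀ c, y c = ∑ b, Q c b • y b + e c) {c : C} (hc : c ∈ J) {q : M}
    (hq : q ∈ Submodule.span T (y '' (K ∪ (ZK ∪ ZJ) : Finset C))) :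
    ∃ q' ∈ Submodule.span T (y '' (ZK ∪ ZJ : Finset C)),
      y c - q' ∈ Submodule.span T (e '' (J ∪ ZJ : Finset C)) ∧
      q - q' ∈ Submodule.span T (e '' (K ∪ ZK : Finset C)) := by
  set Z := ZK ∪ ZJ with hZ
  set YZ := Submodule.span T (y '' Z) with hYZ
  set SK := Submodule.span T (e '' (K ∪ ZK : Finset C)) with hSK
  set SJ := Submodule.span T (e '' (J ∪ ZJ : Finset C)) with hSJ
  -- The response of each of the blocks `K` and `J` to its own inputs, with all signals outside the
  -- block set to zero.
  set η : C → M := fun c =>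
    if c ∈ K then ∑ a, NK c a • e a else if c ∈ J then ∑ a, NJ c a • e a else 0 with hη
  have ηK : ∀ c ∈ K, η c = ∑ a, NK c a • e a := fun c hc => by simp [hη, hc]
  have ηJ : ∀ c ∈ J, η c = ∑ a, NJ c a • e a := fun c hc => by
    simp [hη, hc, Finset.disjoint_right.1 hKJ hc]
  have ηO : ∀ c, c ∉ K → c ∉ J → η c = 0 := fun c h1 h2 => by simp [hη, h1, h2]
  have ηZ : ∀ c ∈ Z, η c = 0 := fun c hc =>
    ηO c (Finset.disjoint_right.1 hKZ hc) (Finset.disjoint_right.1 hJZ hc)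
  have ηSK : ∀ c ∈ K, η c ∈ SK := fun c hc => by
    rw [ηK c hc]
    exact Submodule.span_mono (Set.image_mono (by simp)) (hNK.sum_smul_mem e c)
  have ηSJ : ∀ c ∈ J, η c ∈ SJ := fun c hc => by
    rw [ηJ c hc]
    exact Submodule.span_mono (Set.image_mono (by simp)) (hNJ.sum_smul_mem e c)
  have memK : ∀ c ∈ K, y c - η c ∈ YZ := fun c hc => by
    rw [ηK c hc]
    exact hNK.sub_sum_smul_mem hy (fun c hc => hQK c (Finset.mem_union_left _ hc)) hc
  have memJ : ∀ c ∈ J, y c - η c ∈ YZ := fun c hc => by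
    rw [ηJ c hc]
    exact hNJ.sub_sum_smul_mem hy (fun c hc => hQJ c (Finset.mem_union_left _ hc)) hc
  have yZ : ∀ c ∈ Z, y c ∈ YZ := fun c hc => Submodule.subset_span ⟨c, hc, rfl⟩
  -- the innovations of `Z`
  set ε : C → M := fun c => e c + ∑ b, Q c b • η b with hε
  have parent : ∀ c ∈ Z, ∀ b, b ∉ K ∪ J ∪ Z → Q c b = 0 := by
    intro c hc b hb
    simp only [Finset.mem_union, not_or] at hb
    rcases Finset.mem_union.1 hc with hc | hc
    · exact hQK c (Finset.mem_union_right _ hc) b hb.1.1 (by simp [hb.2])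
    · exact hQJ c (Finset.mem_union_right _ hc) b hb.1.2 (by simp [hb.2])
  -- The definition of `ε` shows which inputs it involves; this second form shows that it is a
  -- combination of the signals of `Z`.
  have ε_eq : ∀ c, ε c = y c - ∑ b, Q c b • (y b - η b) := fun c => by
    simp only [hε, smul_sub, Finset.sum_sub_distrib]
    nth_rw 1 [hy c]
    abel
  have εY : ∀ c ∈ Z, ε c ∈ YZ := by
    intro c hc
    rw [ε_eq]
    refine Submodule.sub_mem _ (yZ c hc) (Submodule.sum_mem _ fun b _ => ?_)
    by_cases hb : b ∈ K ∪ J ∪ Z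
    · refine Submodule.smul_mem _ _ ?_
      rcases Finset.mem_union.1 hb with hb | hb
      · rcases Finset.mem_union.1 hb with hb | hb
        · exact memK b hb
        · exact memJ b hb
      · rw [ηZ b hb, sub_zero]
        exact yZ b hb
    · rw [parent c hc b hb, zero_smul]
      exact Submodule.zero_mem _
  have εK : ∀ c ∈ ZK, ε c ∈ SK := by
    intro c hc
    refine Submodule.add_mem _ (Submodule.subset_span ⟨c, by simp [hc], rfl⟩)
      (Submodule.sum_mem _ fun b _ => ?_)
    by_cases hb : b ∈ K
    · exact Submodule.smul_mem _ _ (ηSK b hb)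
    · by_cases hbZ : b ∈ Z
      · simp [ηZ b hbZ]
      · simp [hQK c (Finset.mem_union_right _ hc) b hb hbZ]
  have εJ : ∀ c ∈ ZJ, ε c ∈ SJ := by
    intro c hc
    refine Submodule.add_mem _ (Submodule.subset_span ⟨c, by simp [hc], rfl⟩)
      (Submodule.sum_mem _ fun b _ => ?_)
    by_cases hb : b ∈ J
    · exact Submodule.smul_mem _ _ (ηSJ b hb)
    · by_cases hbZ : b ∈ Z
      · simp [ηZ b hbZ]
      · simp [hQJ c (Finset.mem_union_right _ hc) b hb hbZ]
  -- The signal `y - η`, cut off to `K ∪ J ∪ Z`, solves the network equations with right side `ε -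
  -- η`. This vanishes on `K` and `J`, where `η` solves the equations itself, and equals `ε` on `Z`.
  -- Inverting the block writes `y_Z` through the innovations of `Z`, each belonging to one side.
  have hsplit : YZ ≤ (YZ ⊓ SK) ⊔ (YZ ⊓ SJ) := by
    rw [hYZ, Submodule.span_le]
    rintro _ ⟨z, hz, rfl⟩
    set x : C → M := fun b => if b ∈ K ∪ J ∪ Z then y b - η b else 0 with hx
    have hxz : x z = y z := by
      have : z ∈ K ∪ J ∪ Z := Finset.mem_union_right _ hz
      simp only [hx, this, if_true, ηZ z hz, sub_zero]
    have h1 := hNA.sum_smul_sub (x := x) (fun b hb => by simp only [hx, hb, if_false])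
      (Finset.mem_union_right _ hz : z ∈ K ∪ J ∪ Z)
    rw [hxz] at h1
    rw [SetLike.mem_coe, ← h1]
    have hxQ : ∀ a ∈ K ∪ J ∪ Z, x a - ∑ b, Q a b • x b = ε a - η a := by
      intro a ha
      have hxa : x a = y a - η a := by simp only [hx, ha, if_true]
      have : ∀ b, Q a b • x b = Q a b • (y b - η b) := by
        intro b
        by_cases hb : b ∈ K ∪ J ∪ Z
        · simp only [hx, hb, if_true]
        · have : Q a b = 0 := by
            rcases Finset.mem_union.1 ha with ha | ha
            · simp only [Finset.mem_union, not_or] at hb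
              rcases Finset.mem_union.1 ha with ha | ha
              · exact hQK a (Finset.mem_union_left _ ha) b hb.1.1 hb.2
              · exact hQJ a (Finset.mem_union_left _ ha) b hb.1.2 hb.2
            · exact parent a ha b hb
          simp [this]
      rw [Finset.sum_congr rfl fun b _ => this b, hxa, ε_eq]
      abel
    refine Submodule.sum_mem _ fun a _ => ?_
    by_cases ha : a ∈ K ∪ J ∪ Z
    · refine Submodule.smul_mem _ _ ?_
      rw [hxQ a ha]
      rcases Finset.mem_union.1 ha with ha | ha
      · have h0 : ε a - η a = 0 := by
          rcases Finset.mem_union.1 ha with ha | ha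
          · have h2 := hNK.sub_sum_smul e ha
            have h3 : ∀ b, Q a b • η b = Q a b • ∑ a, NK b a • e a := by
              intro b
              by_cases hb : b ∈ K
              · rw [ηK b hb]
              · by_cases hbZ : b ∈ Z
                · simp [ηZ b hbZ, hNK.left_zero b _ hb]
                · simp [hQK a (Finset.mem_union_left _ ha) b hb hbZ]
            simp only [hε]
            rw [Finset.sum_congr rfl fun b _ => h3 b, ηK a ha]
            nth_rw 1 [← h2]
            abel
          · have h2 := hNJ.sub_sum_smul e ha
            have h3 : ∀ b, Q a b • η b = Q a b • ∑ a, NJ b a • e a := by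
              intro b
              by_cases hb : b ∈ J
              · rw [ηJ b hb]
              · by_cases hbZ : b ∈ Z
                · simp [ηZ b hbZ, hNJ.left_zero b _ hb]
                · simp [hQJ a (Finset.mem_union_left _ ha) b hb hbZ]
            simp only [hε]
            rw [Finset.sum_congr rfl fun b _ => h3 b, ηJ a ha]
            nth_rw 1 [← h2]
            abel
        rw [h0]
        exact Submodule.zero_mem _
      · rw [ηZ a ha, sub_zero]
        rcases Finset.mem_union.1 ha with ha' | ha'
        · exact Submodule.mem_sup_left ⟨εY a ha, εK a ha'⟩
        · exact Submodule.mem_sup_right ⟨εY a ha, εJ a ha'⟩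
    · rw [hNA.right_zero z a ha, zero_smul]
      exact Submodule.zero_mem _
  have hq' : q ∈ SK ⊔ (YZ ⊓ SJ) := by
    have hle : YZ ≤ SK ⊔ (YZ ⊓ SJ) := hsplit.trans (sup_le_sup_right inf_le_right _)
    refine (Submodule.span_le.2 ?_) hq
    rintro _ ⟨k, hk, rfl⟩
    rcases Finset.mem_union.1 hk with hk | hk
    · rw [SetLike.mem_coe, ← sub_add_cancel (y k) (η k)]
      exact Submodule.add_mem _ (hle (memK k hk)) (Submodule.mem_sup_left (ηSK k hk))
    · exact hle (yZ k hk)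
  obtain ⟨a, ha, b, hb, rfl⟩ := Submodule.mem_sup.1 hq'
  obtain ⟨p₁, hp₁, p₂, hp₂, hp⟩ := Submodule.mem_sup.1 (hsplit (memJ c hc))
  -- With `q = a + b` and `y c - η c = p₁ + p₂`, take the part on the side of `K` from the
  -- prediction of `y c` and the other part from `q`; both differences then involve one side only.
  refine ⟨p₁ + b, Submodule.add_mem _ hp₁.1 hb.1, ?_, ?_⟩
  · have : y c - (p₁ + b) = p₂ + η c - b := by
      rw [← sub_add_cancel (y c) (η c), ← hp]
      abel
    rw [this]
    exact Submodule.sub_mem _ (Submodule.add_mem _ hp₂.2 (ηSJ c hc)) hb.2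
  · have : a + b - (p₁ + b) = a - p₁ := by abel
    rw [this]
    exact Submodule.sub_mem _ ha hp₁.2

end LinearEquations

/-! ### Processes as bounded sequences of square integrable functions -/

section Representation

variable {Ω : Type*} [MeasurableSpace Ω] {μ : Measure Ω}

/-- The process `x` agrees almost surely with the bounded sequence `X` in `L²`. -/
def Represents (μ : Measure Ω) (x : ℤ → Ω → ℝ) (X : ℤ →ᵇ Lp ℝ 2 μ) : Prop :=
  ∀ t, x t =ᵐ[μ] X t

theorem Represents.unique {x : ℤ → Ω → ℝ} {X Y : ℤ →ᵇ Lp ℝ 2 μ} (hX : Represents μ x X)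
    (hY : Represents μ x Y) : X = Y := by
  ext1 t
  exact Lp.ext ((hX t).symm.trans (hY t))

theorem Represents.inner_eq {x y : ℤ → Ω → ℝ} {X Y : ℤ →ᵇ Lp ℝ 2 μ} (hX : Represents μ x X)
    (hY : Represents μ y Y) (s t : ℤ) : inner ℝ (X s) (Y t) = ∫ ω, x s ω * y t ω ∂μ := by
  rw [L2.inner_def]
  refine integral_congr_ae ?_
  filter_upwards [hX s, hY t] with ω h1 h2
  simp [h1, h2, mul_comm]

/-- The constant second moment bounds the sequence in `L²`. -/
theorem exists_represents {x : ℤ → Ω → ℝ} (hx : ∀ t, MemLp (x t) 2 μ) {C : ℝ}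
    (hC : ∀ t, ∫ ω, x t ω * x t ω ∂μ = C) : ∃ X, Represents μ x X := by
  refine ⟨BoundedContinuousFunction.ofNormedAddCommGroupDiscrete (fun t => (hx t).toLp (x t))
    (√C) fun t => ?_, fun t => ((hx t).coeFn_toLp).symm⟩
  refine Real.le_sqrt_of_sq_le ?_
  rw [← real_inner_self_eq_norm_sq, L2.inner_def, ← hC t]
  refine (integral_congr_ae ?_).le
  filter_upwards [(hx t).coeFn_toLp] with ω h
  simp [h, sq]

theorem IsWSS.exists_represents {ι : Type*} {x : ι → ℤ → Ω → ℝ} (hx : IsWSS μ x) :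
    ∃ X : ι → ℤ →ᵇ Lp ℝ 2 μ, ∀ a, Represents μ (x a) (X a) := by
  choose X hX using fun a => _root_.exists_represents (hx.memLp a)
    (C := ∫ ω, x a 0 ω * x a 0 ω ∂μ) fun t => by simpa using hx.corr a a t 0
  exact ⟨X, hX⟩

theorem IsUnitWhite.exists_represents {ι : Type*} [DecidableEq ι] {u : ι → ℤ → Ω → ℝ}
    (hu : IsUnitWhite μ u) : ∃ U : ι → ℤ →ᵇ Lp ℝ 2 μ, ∀ a, Represents μ (u a) (U a) := by
  choose U hU using fun a => _root_.exists_represents (hu.memLp a) (C := 1)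
    fun t => by simpa using hu.corr a a t t
  exact ⟨U, hU⟩

/-- The terms have summable `L²` norms, so the pointwise series agrees almost surely with the sum in
`L²`. -/
theorem Represents.filter {x : ℤ → Ω → ℝ} {X : ℤ →ᵇ Lp ℝ 2 μ} (h : Represents μ x X)
    (P : tfRing) : Represents μ (fun t ω => ∑' k : ℤ, impulse (P : RatFunc ℝ) (t - k) * x k ω)
      (P • X) := by
  intro t
  have h1 := hasSum_tf_smul_apply' P X t
  have hs : Summable fun k => ‖resp P (t - k) • X k‖ := by
    have h2 : Summable fun k => ‖resp P (t - k)‖ * ‖X‖ := by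
      have := (Equiv.subLeft t).summable_iff.2 (summable_norm_resp P)
      have h : Summable fun k => ‖resp P (t - k)‖ := by simpa [Function.comp_def] using this
      exact h.mul_right _
    refine h2.of_nonneg_of_le (fun _ => norm_nonneg _) fun k => ?_
    rw [norm_smul]
    exact mul_le_mul_of_nonneg_left (X.norm_coe_le_norm k) (norm_nonneg _)
  have h3 := Lp.coeFn_tsum (f := fun k => resp P (t - k) • X k)
    (tsum_enorm_ne_top_iff_summable_norm.2 hs)
  rw [h1.tsum_eq] at h3
  have h4 : ∀ᵐ ω ∂μ, ∀ k, x k ω = X k ω := ae_all_iff.2 h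
  have h5 : ∀ᵐ ω ∂μ, ∀ k, (resp P (t - k) • X k : Lp ℝ 2 μ) ω = resp P (t - k) * X k ω :=
    ae_all_iff.2 fun k => Lp.coeFn_smul _ _
  filter_upwards [h3, h4, h5] with ω h3 h4 h5
  simp only [h3, h4, h5]
  rfl

theorem Represents.applyTF {ι κ : Type*} [Fintype ι] {W : Matrix κ ι (RatFunc ℝ)}
    {x : ι → ℤ → Ω → ℝ} {X : ι → ℤ →ᵇ Lp ℝ 2 μ} (h : ∀ b, Represents μ (x b) (X b)) {a : κ}
    {w : ι → tfRing} (hw : ∀ b, (w b : RatFunc ℝ) = W a b) :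
    Represents μ (applyTF W x a) (∑ b, w b • X b) := by
  intro t
  have h1 : ((∑ b, w b • X b : ℤ →ᵇ Lp ℝ 2 μ) t) = ∑ b, (w b • X b) t := by
    simp
  rw [h1]
  have h2 := Lp.coeFn_fun_finsetSum Finset.univ fun b => (w b • X b) t
  have h3 : ∀ᵐ ω ∂μ, ∀ b, ∑' k : ℤ, impulse (W a b) (t - k) * x b k ω = (w b • X b) t ω :=
    ae_all_iff.2 fun b => by
      rw [← hw b]
      exact (h b).filter (w b) t
  filter_upwards [h2, h3] with ω h2 h3
  rw [h2]
  exact Finset.sum_congr rfl fun b _ => h3 b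

theorem mse_eq {κ : Type*} [Fintype κ] {x q : κ → ℤ → Ω → ℝ} {X Y : κ → ℤ →ᵇ Lp ℝ 2 μ}
    (hx : ∀ a, Represents μ (x a) (X a)) (hq : ∀ a, Represents μ (q a) (Y a)) (t : ℤ) :
    mse μ x q t = ∑ a, ‖X a t - Y a t‖ ^ 2 := by
  have h1 : ∀ a, (fun ω => (x a t ω - q a t ω) ^ 2) =ᵐ[μ]
      fun ω => inner ℝ ((X a t - Y a t) ω) ((X a t - Y a t) ω) := by
    intro a
    filter_upwards [hx a t, hq a t, Lp.coeFn_sub (X a t) (Y a t)] with ω h1 h2 h3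
    rw [h1, h2, h3]
    simp [sq]
  rw [mse, integral_finsetSum]
  · refine Finset.sum_congr rfl fun a _ => ?_
    rw [← real_inner_self_eq_norm_sq, L2.inner_def]
    exact integral_congr_ae (h1 a)
  · intro a _
    exact (L2.integrable_inner (𝕜 := ℝ) (X a t - Y a t) (X a t - Y a t)).congr (h1 a).symm

end Representation

/-! ### Correlations of filtered sequences -/

section Correlation

variable {H : Type*} [NormedAddCommGroup H] [InnerProductSpace ℝ H]

/-- All values of the two sequences are orthogonal. -/
def SeqOrthogonal (x z : ℤ →ᵇ H) : Prop := ∀ t s, inner ℝ (x t) (z s) = 0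

theorem SeqOrthogonal.symm {x z : ℤ →ᵇ H} (h : SeqOrthogonal x z) : SeqOrthogonal z x :=
  fun t s => by rw [real_inner_comm, h s t]

theorem SeqOrthogonal.add_left {x y z : ℤ →ᵇ H} (hx : SeqOrthogonal x z)
    (hy : SeqOrthogonal y z) : SeqOrthogonal (x + y) z := fun t s => by
  rw [BoundedContinuousFunction.add_apply, inner_add_left, hx t s, hy t s, add_zero]

theorem SeqOrthogonal.zero_left (z : ℤ →ᵇ H) : SeqOrthogonal 0 z := fun t s => by simp

theorem SeqOrthogonal.sum_left {ι : Type*} {s : Finset ι} {x : ι → ℤ →ᵇ H} {z : ℤ →ᵇ H}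
    (h : ∀ i ∈ s, SeqOrthogonal (x i) z) : SeqOrthogonal (∑ i ∈ s, x i) z := fun t r => by
  rw [BoundedContinuousFunction.sum_apply, sum_inner]
  exact Finset.sum_eq_zero fun i hi => h i hi t r

theorem norm_sub_sq_of_seqOrthogonal {x q q' : ℤ →ᵇ H} (h : SeqOrthogonal (x - q') (q - q'))
    (t : ℤ) : ‖x t - q t‖ ^ 2 = ‖x t - q' t‖ ^ 2 + ‖q t - q' t‖ ^ 2 := by
  have h1 : x t - q t = (x t - q' t) - (q t - q' t) := by abel
  have h2 : inner ℝ (x t - q' t) (q t - q' t) = 0 := h t t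
  rw [h1, norm_sub_sq_real, h2]
  ring

variable [CompleteSpace H]

theorem hasSum_inner_tf_smul (P : tfRing) (x : ℤ →ᵇ H) (t : ℤ) (h : H) :
    HasSum (fun k => resp P k * inner ℝ (x (t - k)) h) (inner ℝ ((P • x) t) h) := by
  have := (hasSum_tf_smul_apply P x t).mapL (innerSL ℝ h)
  simpa [real_inner_comm] using this

theorem inner_tf_smul_eq_resp {x z : ℤ →ᵇ H} {F : tfRing}
    (h : ∀ t s, inner ℝ (x t) (z s) = resp F (t - s)) (P : tfRing) (t s : ℤ) :
    inner ℝ ((P • x) t) (z s) = resp (P * F) (t - s) := by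
  rw [resp_mul, ← (hasSum_inner_tf_smul P x t (z s)).tsum_eq]
  refine tsum_congr fun k => ?_
  rw [h, sub_right_comm]

theorem resp_sum {ι : Type*} (s : Finset ι) (f : ι → tfRing) (k : ℤ) :
    resp (∑ i ∈ s, f i) k = ∑ i ∈ s, resp (f i) k :=
  map_sum (AddMonoidHom.mk' (fun P => resp P k) fun P Q => resp_add P Q k) f s

theorem inner_sum_tf_smul_eq_resp {ι : Type*} [Fintype ι] {x : ι → ℤ →ᵇ H} {z : ℤ →ᵇ H}
    {F : ι → tfRing} (h : ∀ b t s, inner ℝ (x b t) (z s) = resp (F b) (t - s)) (W : ι → tfRing)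
    (t s : ℤ) :
    inner ℝ ((∑ b, W b • x b : ℤ →ᵇ H) t) (z s) = resp (∑ b, W b * F b) (t - s) := by
  rw [BoundedContinuousFunction.sum_apply, sum_inner, resp_sum]
  exact Finset.sum_congr rfl fun b _ => inner_tf_smul_eq_resp (h b) (W b) t s

theorem SeqOrthogonal.smul_left {x z : ℤ →ᵇ H} (h : SeqOrthogonal x z) (P : tfRing) :
    SeqOrthogonal (P • x) z := fun t s => by
  rw [← (hasSum_inner_tf_smul P x t (z s)).tsum_eq]
  simp [h (t - _) s]

theorem SeqOrthogonal.of_mem_span_left {T : Subring tfRing} {A : Set (ℤ →ᵇ H)} {x z : ℤ →ᵇ H}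
    (h : ∀ a ∈ A, SeqOrthogonal a z) (hx : x ∈ Submodule.span T A) : SeqOrthogonal x z := by
  induction hx using Submodule.span_induction with
  | mem a ha => exact h a ha
  | zero => exact .zero_left z
  | add x y _ _ hx hy => exact hx.add_left hy
  | smul P x _ hx => exact hx.smul_left (P : tfRing)

theorem SeqOrthogonal.of_mem_span {T : Subring tfRing} {A B : Set (ℤ →ᵇ H)} {x z : ℤ →ᵇ H}
    (h : ∀ a ∈ A, ∀ b ∈ B, SeqOrthogonal a b) (hx : x ∈ Submodule.span T A)
    (hz : z ∈ Submodule.span T B) : SeqOrthogonal x z :=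
  .of_mem_span_left (fun a ha => (SeqOrthogonal.of_mem_span_left
    (fun b hb => (h a ha b hb).symm) hz).symm) hx

/-- Correlations of filtered white noise have a rational spectrum. -/
theorem exists_spectrum_of_white {C : Type*} [Fintype C] [DecidableEq C] {U : C → ℤ →ᵇ H}
    (hU : ∀ a b t s, inner ℝ (U a t) (U b s) = if a = b ∧ t = s then (1 : ℝ) else 0)
    (F G : C → tfRing) : ∃ R : tfRing, ∀ t s,
      inner ℝ ((∑ c, F c • U c : ℤ →ᵇ H) t) ((∑ c, G c • U c : ℤ →ᵇ H) s) = resp R (t - s) := by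
  -- Filtering the second argument of a correlation by `G` convolves it with the time reversal of
  -- `G`; the spectrum is the sum of the products `F(z) G(1/z)`.
  choose G' hG' using fun c => exists_time_reversal (G c)
  refine ⟨∑ c, F c * G' c, inner_sum_tf_smul_eq_resp (fun c t s => ?_) F⟩
  rw [hG', real_inner_comm, BoundedContinuousFunction.sum_apply, sum_inner,
    Finset.sum_eq_single c]
  · have h1 : ∀ t s, inner ℝ (U c t) (U c s) = resp 1 (t - s) := fun t s => by
      rw [hU, resp_one]
      simp [sub_eq_zero]
    rw [inner_tf_smul_eq_resp h1, mul_one, neg_sub]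
  · intro b _ hb
    have : SeqOrthogonal (U b) (U c) := fun t s => by rw [hU, if_neg fun h => hb h.1]
    exact this.smul_left (G b) s t
  · simp

end Correlation

/-! ### Existence and uniqueness of Wiener filters -/

section Wiener

variable {H : Type*} [NormedAddCommGroup H] [InnerProductSpace ℝ H]

/-- The correlations of `h` with the sequence `y`, in reversed time. -/
def corrSeq (y : ℤ →ᵇ H) : H →L[ℝ] (ℤ →ᵇ ℝ) :=
  LinearMap.mkContinuous
    { toFun := fun h => BoundedContinuousFunction.ofNormedAddCommGroupDiscrete
        (fun τ => inner ℝ h (y (-τ))) (‖h‖ * ‖y‖) fun τ =>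
          (norm_inner_le_norm _ _).trans
            (mul_le_mul_of_nonneg_left (y.norm_coe_le_norm _) (norm_nonneg _))
      map_add' := fun _ _ => by
        ext
        simp [inner_add_left]
      map_smul' := fun _ _ => by
        ext
        simp [inner_smul_left] } ‖y‖
    fun h => (BoundedContinuousFunction.norm_le (by positivity)).2 fun τ => by
      rw [mul_comm]
      exact (norm_inner_le_norm _ _).trans
        (mul_le_mul_of_nonneg_left (y.norm_coe_le_norm _) (norm_nonneg _))

@[simp]
theorem corrSeq_apply (y : ℤ →ᵇ H) (h : H) (τ : ℤ) : corrSeq y h τ = inner ℝ h (y (-τ)) := rfl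

variable [CompleteSpace H]

variable {ι : Type*} [Fintype ι]

/-- The causal part of the Wiener-Hopf equation has rational solutions only: if `Φ w = φ + g` with
`w` causal and `g` strictly anticausal, then `φ + g` is rational. -/
theorem exists_rational_of_wienerHopf {Φ : Matrix ι ι tfRing} {φ : ι → tfRing}
    {w α : ι → ℤ →ᵇ ℝ} (hw : ∀ b, ∀ k < 0, w b k = 0) (hα : ∀ c, α c = ∑ b, Φ b c • w b)
    (hg : ∀ c k, 0 ≤ k → α c k = resp (φ c) k) :
    ∃ β : ι → tfRing, ∀ c, α c = β c • unitImpulse := by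
  obtain ⟨D, ⟨v, hv⟩, hD⟩ := exists_common_denom
    (Sum.elim φ fun bc : ι × ι => Φ bc.1 bc.2)
  choose F hF using fun c => hD (Sum.inl c)
  choose n hn using fun b c => hD (Sum.inr (b, c))
  simp only [Sum.elim_inl, Sum.elim_inr] at hF hn
  have key : ∀ c, ∃ p : Polynomial ℝ, polyTF D • α c = polyTF p • unitImpulse := by
    intro c
    -- Clearing denominators makes the sequence finite. At positive times it vanishes because `α`
    -- differs from `φ` only at negative times and `D`, `D φ` are polynomials, hence only advance.
    -- At very negative times it vanishes because `D Φ` is polynomial and `w` is causal.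
    refine exists_polyTF_smul_unitImpulse (n := ∑ b, (n b c).natDegree) (fun k hk => ?_)
      fun k hk => ?_
    · have h1 : polyTF D • α c = polyTF (F c) • unitImpulse +
          polyTF D • (α c - φ c • unitImpulse) := by
        rw [smul_sub, smul_smul, hF]
        abel
      have h2 : (polyTF D • (α c - φ c • unitImpulse)) k = 0 := by
        refine polyTF_smul_apply_eq_zero (n := 0) D (fun j hj => ?_) (by lia)
        rw [BoundedContinuousFunction.sub_apply, tf_smul_unitImpulse, hg c j hj, sub_self]
      rw [h1, BoundedContinuousFunction.add_apply, h2, tf_smul_unitImpulse, resp_polyTF,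
        if_neg (by lia), add_zero]
    · rw [hα, Finset.smul_sum, BoundedContinuousFunction.sum_apply]
      refine Finset.sum_eq_zero fun b _ => ?_
      rw [smul_smul, hn]
      refine polyTF_smul_apply_eq_zero_of_lt _ (hw b) ?_
      have := Finset.single_le_sum (f := fun b => (n b c).natDegree) (fun _ _ => Nat.zero_le _)
        (Finset.mem_univ b)
      lia
  choose p hp using key
  refine ⟨fun c => ↑v⁻¹ * polyTF (p c), fun c => ?_⟩
  rw [mul_smul, ← hp, ← hv, smul_smul, Units.inv_mul, one_smul]

/-- Project `x 0` onto the closed span of the observations `y b (-k)` with admissible delays `k ∈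
K`. Applying `Φ⁻¹` to correlations defines continuous maps `w b` that read off the coefficients of
finite combinations; by continuity they vanish outside `K` on the closed span, so `w b p` is the
candidate filter. It is rational once the correlations of `p` are: these equal `φ` if `K` is
everything, and are covered by `exists_rational_of_wienerHopf` if `K` is the nonnegative delays. -/
theorem exists_wiener_filter [DecidableEq ι] {y : ι → ℤ →ᵇ H} {x : ℤ →ᵇ H} {Φ : Matrix ι ι tfRing}
    (hΦ : ∀ b c t s, inner ℝ (y b t) (y c s) = resp (Φ b c) (t - s)) {φ : ι → tfRing}
    (hφ : ∀ c t s, inner ℝ (x t) (y c s) = resp (φ c) (t - s)) (hdet : IsUnit Φ.det) {K : Set ℤ}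
    (hK : K = Set.univ ∨ K = Set.Ici 0) :
    ∃ W : ι → tfRing, (∀ b, ∀ k ∉ K, resp (W b) k = 0) ∧
      ∀ c, ∀ τ ∈ K, ∀ t, inner ℝ (x t - (∑ b, W b • y b : ℤ →ᵇ H) t) (y c (t - τ)) = 0 := by
  set Ψ := Φ⁻¹ with hΨ
  have hΦΨ : ∀ b b', ∑ c, Φ b c * Ψ c b' = if b = b' then 1 else 0 := fun b b' => by
    rw [← Matrix.mul_apply, Matrix.mul_nonsing_inv Φ hdet, Matrix.one_apply]
  have hΨΦ : ∀ c c', ∑ b, Ψ c b * Φ b c' = if c = c' then 1 else 0 := fun b b' => by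
    rw [← Matrix.mul_apply, Matrix.nonsing_inv_mul Φ hdet, Matrix.one_apply]
  let w : ι → H →L[ℝ] (ℤ →ᵇ ℝ) := fun b => ∑ c, (convHom ℝ (Ψ c b)).comp (corrSeq (y c))
  have hw : ∀ b h, w b h = ∑ c, Ψ c b • corrSeq (y c) h := fun b h => by
    simp [w, tf_smul_def]
  have hcorr : ∀ b c k, corrSeq (y c) (y b (-k)) = Φ b c • delay k unitImpulse := by
    intro b c k
    ext τ
    rw [corrSeq_apply, hΦ, tf_smul_delay, delay_apply, tf_smul_unitImpulse]
    congr 1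
    ring
  have hwy : ∀ b b' k, w b' (y b (-k)) = if b = b' then delay k unitImpulse else 0 := by
    intro b b' k
    simp only [hw, hcorr, smul_smul]
    rw [← Finset.sum_smul]
    simp only [mul_comm (Ψ _ _)]
    rw [hΦΨ]
    split_ifs <;> simp
  set M : Submodule ℝ H := (Submodule.span ℝ {h | ∃ b, ∃ k ∈ K, h = y b (-k)}).topologicalClosure
    with hM
  have hMc : IsClosed (M : Set H) := Submodule.isClosed_topologicalClosure _
  have : CompleteSpace M := hMc.completeSpace_coe
  have hyM : ∀ b, ∀ k ∈ K, y b (-k) ∈ M := fun b k hk =>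
    Submodule.le_topologicalClosure _ (Submodule.subset_span ⟨b, k, hk, rfl⟩)
  have hwM : ∀ b, ∀ h ∈ M, ∀ j ∉ K, w b h j = 0 := by
    intro b h hh j hj
    have hle : M ≤ LinearMap.ker
        (((BoundedContinuousFunction.evalCLM ℝ j).comp (w b) : H →L[ℝ] ℝ) : H →ₗ[ℝ] ℝ) := by
      refine Submodule.topologicalClosure_minimal _ (Submodule.span_le.2 ?_)
        (ContinuousLinearMap.isClosed_ker ((BoundedContinuousFunction.evalCLM ℝ j).comp (w b)))
      rintro _ ⟨b', k, hk, rfl⟩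
      have : w b (y b' (-k)) j = 0 := by
        rw [hwy]
        split_ifs
        · rw [delay_apply, unitImpulse_apply, if_neg]
          intro h0
          exact hj ((sub_eq_zero.1 h0) ▸ hk)
        · rfl
      simpa using this
    simpa using hle hh
  set p : H := M.starProjection (x 0) with hp
  have hpM : p ∈ M := Submodule.starProjection_apply_mem _ _
  have horth : ∀ c, ∀ τ ∈ K, corrSeq (y c) p τ = resp (φ c) τ := by
    intro c τ hτ
    have h1 : inner ℝ (x 0 - p) (y c (-τ)) = 0 :=
      Submodule.starProjection_inner_eq_zero _ _ (hyM c τ hτ)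
    rw [inner_sub_left, hφ, sub_eq_zero] at h1
    rw [corrSeq_apply, ← h1]
    congr 1
    ring
  have hα : ∀ c, corrSeq (y c) p = ∑ b, Φ b c • w b p := by
    intro c
    simp only [hw, Finset.smul_sum, smul_smul]
    rw [Finset.sum_comm]
    simp only [← Finset.sum_smul, mul_comm (Φ _ _), hΨΦ]
    simp [ite_smul]
  obtain ⟨β, hβ⟩ : ∃ β : ι → tfRing, ∀ c, corrSeq (y c) p = β c • unitImpulse := by
    rcases hK with rfl | rfl
    · refine ⟨φ, fun c => ?_⟩
      ext τ
      rw [horth c τ (Set.mem_univ τ), tf_smul_unitImpulse]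
    · exact exists_rational_of_wienerHopf (w := fun b => w b p)
        (fun b k hk => hwM b p hpM k (by simpa using hk)) hα fun c k hk => horth c k hk
  refine ⟨fun b => ∑ c, Ψ c b * β c, fun b k hk => ?_, fun c τ hτ t => ?_⟩
  · rw [← tf_smul_unitImpulse, ← hwM b p hpM k hk, hw, Finset.sum_smul]
    simp only [mul_smul, hβ]
  · rw [inner_sub_left, hφ, inner_sum_tf_smul_eq_resp (fun b => hΦ b c), sub_sub_cancel]
    have h1 : ∑ b, (∑ c', Ψ c' b * β c') * Φ b c = β c := by
      simp only [Finset.sum_mul]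
      rw [Finset.sum_comm]
      have : ∀ c', ∑ b, Ψ c' b * β c' * Φ b c = β c' * if c' = c then 1 else 0 := fun c' => by
        rw [← hΨΦ c' c, Finset.mul_sum]
        exact Finset.sum_congr rfl fun b _ => by ring
      simp [this]
    rw [h1, ← horth c τ hτ, hβ, tf_smul_unitImpulse, sub_self]

/-- Orthogonality to the past makes the error orthogonal to all estimates. -/
theorem inner_estimate_eq_zero {y : ι → ℤ →ᵇ H} {r : ℤ →ᵇ H} {K : Set ℤ}
    (hr : ∀ c, ∀ τ ∈ K, ∀ t, inner ℝ (r t) (y c (t - τ)) = 0) {V : ι → tfRing}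
    (hV : ∀ b, ∀ k ∉ K, resp (V b) k = 0) (t : ℤ) :
    inner ℝ (r t) ((∑ b, V b • y b : ℤ →ᵇ H) t) = 0 := by
  rw [real_inner_comm, BoundedContinuousFunction.sum_apply, sum_inner]
  refine Finset.sum_eq_zero fun b _ => ?_
  rw [← (hasSum_inner_tf_smul (V b) (y b) t (r t)).tsum_eq]
  refine (tsum_congr fun k => ?_).trans tsum_zero
  by_cases hk : k ∈ K
  · rw [real_inner_comm, hr b k hk t, mul_zero]
  · rw [hV b k hk, zero_mul]

/-- A process with an invertible spectrum has no linear relations. -/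
theorem eq_zero_of_sum_tf_smul_eq_zero [DecidableEq ι] {y : ι → ℤ →ᵇ H} {Φ : Matrix ι ι tfRing}
    (hΦ : ∀ b c t s, inner ℝ (y b t) (y c s) = resp (Φ b c) (t - s)) (hdet : IsUnit Φ.det)
    {V : ι → tfRing} (hV : ∑ b, V b • y b = 0) : V = 0 := by
  have h1 : Matrix.vecMul V Φ = 0 := by
    ext1 c
    refine eq_zero_of_resp_eq_zero fun k => ?_
    have h2 := inner_sum_tf_smul_eq_resp (fun b => hΦ b c) V k 0
    rw [hV, sub_zero] at h2
    simp only [Matrix.vecMul, dotProduct]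
    rw [← h2]
    simp
  have h2 := congrArg (fun v => Matrix.vecMul v Φ⁻¹) h1
  simpa [Matrix.vecMul_vecMul, Matrix.mul_nonsing_inv Φ hdet] using h2

end Wiener

/-! ### Wiener estimates in terms of bounded sequences -/

/-- `𝒯` is the class of transfer functions in the ring `T`. -/
def IsClassOf (𝒯 : Set (RatFunc ℝ)) (T : Subring tfRing) : Prop :=
  ∀ P, P ∈ 𝒯 ↔ ∃ h : P ∈ tfRing, (⟨P, h⟩ : tfRing) ∈ T

theorem isClassOf_tfF : IsClassOf tfF ⊤ := fun _ => ⟨fun h => ⟨h, trivial⟩, fun h => h.1⟩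

theorem isClassOf_tfFplus : IsClassOf tfFplus causalRing :=
  fun _ => ⟨fun h => ⟨h.1, h.2⟩, fun ⟨h1, h2⟩ => ⟨h1, h2⟩⟩

theorem IsClassOf.exists_lift {𝒯 : Set (RatFunc ℝ)} {T : Subring tfRing} (h : IsClassOf 𝒯 T)
    {κ ι : Type*} {W : Matrix κ ι (RatFunc ℝ)} (hW : ∀ a b, W a b ∈ 𝒯) :
    ∃ W' : Matrix κ ι T, ∀ a b, ((W' a b : tfRing) : RatFunc ℝ) = W a b :=
  ⟨fun a b => ⟨⟨W a b, ((h _).1 (hW a b)).1⟩, ((h _).1 (hW a b)).2⟩, fun _ _ => rfl⟩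

theorem IsClassOf.coe_mem {𝒯 : Set (RatFunc ℝ)} {T : Subring tfRing} (h : IsClassOf 𝒯 T)
    {P : tfRing} (hP : P ∈ T) : (P : RatFunc ℝ) ∈ 𝒯 := (h _).2 ⟨P.2, hP⟩

section Translation

variable {Ω : Type*} [MeasurableSpace Ω] {μ : Measure Ω} {𝒯 : Set (RatFunc ℝ)}
  {T : Subring tfRing} {ι κ : Type*} [Fintype ι]

theorem exists_of_mem_tfSpan (h𝒯 : IsClassOf 𝒯 T) {y : ι → ℤ → Ω → ℝ} {Y : ι → ℤ →ᵇ Lp ℝ 2 μ}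
    (hY : ∀ b, Represents μ (y b) (Y b)) {q : κ → ℤ → Ω → ℝ} (hq : q ∈ tfSpan μ 𝒯 y κ) :
    ∃ X : κ → ℤ →ᵇ Lp ℝ 2 μ, (∀ a, Represents μ (q a) (X a)) ∧
      ∀ a, X a ∈ Submodule.span T (Set.range Y) := by
  obtain ⟨W, hW, hqW⟩ := hq
  obtain ⟨W', hW'⟩ := h𝒯.exists_lift hW
  refine ⟨fun a => ∑ b, W' a b • Y b, fun a t => ?_, fun a => ?_⟩
  · exact (hqW a t).trans (Represents.applyTF (w := fun b => (W' a b : tfRing)) hY (hW' a) t)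
  · exact Submodule.sum_mem _ fun b _ =>
      Submodule.smul_mem _ _ (Submodule.subset_span (Set.mem_range_self b))

theorem mem_tfSpan_of_represents (h𝒯 : IsClassOf 𝒯 T) {y : ι → ℤ → Ω → ℝ}
    {Y : ι → ℤ →ᵇ Lp ℝ 2 μ} (hY : ∀ b, Represents μ (y b) (Y b)) {q : κ → ℤ → Ω → ℝ}
    {X : κ → ℤ →ᵇ Lp ℝ 2 μ} (hX : ∀ a, Represents μ (q a) (X a))
    (hs : ∀ a, X a ∈ Submodule.span T (Set.range Y)) : q ∈ tfSpan μ 𝒯 y κ := by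
  choose W hW using fun a => (Submodule.mem_span_range_iff_exists_fun T).1 (hs a)
  refine ⟨fun a b => ((W a b : tfRing) : RatFunc ℝ), fun a b => h𝒯.coe_mem (W a b).2,
    fun a t => (hX a t).trans ?_⟩
  rw [← hW a]
  exact (Represents.applyTF (w := fun b => (W a b : tfRing)) hY (fun _ => rfl) t).symm

theorem isWienerEstimate_iff [Fintype κ] (h𝒯 : IsClassOf 𝒯 T) {y : ι → ℤ → Ω → ℝ}
    {Y : ι → ℤ →ᵇ Lp ℝ 2 μ} (hY : ∀ b, Represents μ (y b) (Y b)) {x q : κ → ℤ → Ω → ℝ}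
    {X R : κ → ℤ →ᵇ Lp ℝ 2 μ} (hX : ∀ a, Represents μ (x a) (X a))
    (hR : ∀ a, Represents μ (q a) (R a)) :
    IsWienerEstimate μ 𝒯 y x q ↔ (∀ a, R a ∈ Submodule.span T (Set.range Y)) ∧
      ∀ R' : κ → ℤ →ᵇ Lp ℝ 2 μ, (∀ a, R' a ∈ Submodule.span T (Set.range Y)) →
        ∀ t, ∑ a, ‖X a t - R a t‖ ^ 2 ≤ ∑ a, ‖X a t - R' a t‖ ^ 2 := by
  constructor
  · rintro ⟨h1, h2⟩
    refine ⟨fun a => ?_, fun R' hR' t => ?_⟩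
    · obtain ⟨X', hX', hs⟩ := exists_of_mem_tfSpan h𝒯 hY h1
      rw [(hR a).unique (hX' a)]
      exact hs a
    · have hrep : ∀ a, Represents μ (fun t ω => R' a t ω) (R' a) :=
        fun a t => Filter.EventuallyEq.rfl
      have := h2 _ (mem_tfSpan_of_represents h𝒯 hY hrep hR') t
      rwa [mse_eq hX hR, mse_eq hX hrep] at this
  · rintro ⟨h1, h2⟩
    refine ⟨mem_tfSpan_of_represents h𝒯 hY hR h1, fun q' hq' t => ?_⟩
    obtain ⟨R', hrep, hs⟩ := exists_of_mem_tfSpan h𝒯 hY hq'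
    rw [mse_eq hX hR, mse_eq hX hrep]
    exact h2 R' hs t

end Translation

/-! ### Consequences of orthogonal splitting for estimates and filters. -/

section Separation

variable {V Ω : Type*} [MeasurableSpace Ω] {μ : Measure Ω}
  {𝒯 : Set (RatFunc ℝ)} {T : Subring tfRing} {d : V → ℕ} {y : Comp d → ℤ → Ω → ℝ}
  {Y : Comp d → ℤ →ᵇ Lp ℝ 2 μ} {I Z J : Finset V}

/-- The combinations of the signals of the nodes in `S` with coefficients in `T`. -/
def nodeSpan (T : Subring tfRing) (Y : Comp d → ℤ →ᵇ Lp ℝ 2 μ) (S : Finset V) :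
    Submodule T (ℤ →ᵇ Lp ℝ 2 μ) :=
  Submodule.span T (Set.range fun c : CompOn d S => Y c.1)

theorem nodeSpan_eq (T : Subring tfRing) (Y : Comp d → ℤ →ᵇ Lp ℝ 2 μ) (S : Finset V) :
    nodeSpan T Y S = Submodule.span T (Y '' {c | c.1 ∈ S}) := by
  rw [nodeSpan, Set.image_eq_range]
  rfl

theorem nodeSpan_mono {S S' : Finset V} (h : S ⊆ S') : nodeSpan T Y S ≤ nodeSpan T Y S' := by
  rw [nodeSpan_eq, nodeSpan_eq]
  exact Submodule.span_mono (Set.image_mono fun _ hc => h hc)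

variable [Fintype V] [DecidableEq V]

/-- Every estimate from `(y_I, y_Z)` is an estimate from `y_Z` plus a part that is uncorrelated
with the remaining error. -/
def SeparatedBy (T : Subring tfRing) (Y : Comp d → ℤ →ᵇ Lp ℝ 2 μ) (I Z J : Finset V) : Prop :=
  ∀ a : CompOn d J, ∀ q ∈ nodeSpan T Y (I ∪ Z), ∃ q' ∈ nodeSpan T Y Z,
    SeqOrthogonal (Y a.1 - q') (q - q')

/-- Pythagoras in each component; no minimizer has to exist. -/
theorem SeparatedBy.noImprovement (h : SeparatedBy T Y I Z J) (h𝒯 : IsClassOf 𝒯 T)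
    (hY : ∀ c, Represents μ (y c) (Y c)) : NoImprovement μ 𝒯 y I Z J := by
  intro q hq
  obtain ⟨R, hR, hs⟩ := exists_of_mem_tfSpan h𝒯 (fun b : CompOn d (I ∪ Z) => hY b.1) hq
  choose R' hs' horth using fun a => h a (R a) (hs a)
  have hrep : ∀ a, Represents μ (fun t ω => R' a t ω) (R' a) := fun a t => Filter.EventuallyEq.rfl
  refine ⟨_, mem_tfSpan_of_represents h𝒯 (fun b : CompOn d Z => hY b.1) hrep hs', fun t => ?_⟩
  have hYJ : ∀ a, Represents μ (restrictTo y J a) (Y a.1) := fun a => hY a.1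
  rw [mse_eq hYJ hrep, mse_eq hYJ hR]
  refine Finset.sum_le_sum fun a _ => ?_
  rw [norm_sub_sq_of_seqOrthogonal (horth a)]
  exact le_add_of_nonneg_right (sq_nonneg _)

/-- For an optimal `q`, Pythagoras against its own `q'` forces `q = q'`, so `q` uses `y_Z` only.
Conversely, every competitor from `(y_I, y_Z)` is no better than its `q'`, which competes already
among the estimates from `y_Z`. -/
theorem SeparatedBy.estimatesCoincide (h : SeparatedBy T Y I Z J) (h𝒯 : IsClassOf 𝒯 T)
    (hY : ∀ c, Represents μ (y c) (Y c)) : EstimatesCoincide μ 𝒯 y I Z J := by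
  have hYIZ := fun b : CompOn d (I ∪ Z) => hY b.1
  have hYZ := fun b : CompOn d Z => hY b.1
  have hYJ := fun b : CompOn d J => hY b.1
  have hmono : nodeSpan T Y Z ≤ nodeSpan T Y (I ∪ Z) := nodeSpan_mono Finset.subset_union_right
  intro q
  constructor
  · intro hq
    obtain ⟨R, hR, hs⟩ := exists_of_mem_tfSpan h𝒯 hYIZ hq.1
    choose R' hs' horth using fun a => h a (R a) (hs a)
    have hopt := ((isWienerEstimate_iff h𝒯 hYIZ hYJ hR).1 hq).2
    have heq : R = R' := by
      ext1 a
      ext1 t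
      have h1 := hopt R' (fun a => hmono (hs' a)) t
      simp only [fun a => norm_sub_sq_of_seqOrthogonal (horth a) t, Finset.sum_add_distrib] at h1
      have h2 : ∑ a, ‖R a t - R' a t‖ ^ 2 = 0 :=
        le_antisymm (by linarith) (Finset.sum_nonneg fun _ _ => sq_nonneg _)
      have h3 := (Finset.sum_eq_zero_iff_of_nonneg fun _ _ => sq_nonneg _).1 h2 a
        (Finset.mem_univ a)
      exact sub_eq_zero.1 (norm_eq_zero.1 (pow_eq_zero_iff two_ne_zero |>.1 h3))
    subst heq
    exact (isWienerEstimate_iff h𝒯 hYZ hYJ hR).2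
      ⟨hs', fun R'' hR'' => hopt R'' fun a => hmono (hR'' a)⟩
  · intro hq
    obtain ⟨R, hR, hs⟩ := exists_of_mem_tfSpan h𝒯 hYZ hq.1
    have hopt := ((isWienerEstimate_iff h𝒯 hYZ hYJ hR).1 hq).2
    refine (isWienerEstimate_iff h𝒯 hYIZ hYJ hR).2 ⟨fun a => hmono (hs a), fun R'' hR'' t => ?_⟩
    choose R' hs' horth using fun a => h a (R'' a) (hR'' a)
    refine (hopt R' hs' t).trans (Finset.sum_le_sum fun a _ => ?_)
    rw [norm_sub_sq_of_seqOrthogonal (horth a)]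
    exact le_add_of_nonneg_right (sq_nonneg _)

/-- With an invertible spectrum the Wiener filter exists, is unique and ignores `y_I`. -/
theorem SeparatedBy.filterVanishesOn (h : SeparatedBy T Y I Z J) (h𝒯 : IsClassOf 𝒯 T)
    (hY : ∀ c, Represents μ (y c) (Y c)) (hIZ : Disjoint I Z) {Φ : Matrix (Comp d) (Comp d) tfRing}
    (hΦ : ∀ b c t s, inner ℝ (Y b t) (Y c s) = resp (Φ b c) (t - s))
    (hdet : IsUnit (Φ.submatrix (Subtype.val : CompOn d (I ∪ Z) → Comp d) Subtype.val).det)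
    {K : Set ℤ} (hK : K = Set.univ ∨ K = Set.Ici 0)
    (hTK : ∀ P, P ∈ T ↔ ∀ k ∉ K, resp P k = 0) : FilterVanishesOn μ 𝒯 y I Z J := by
  have hYIZ := fun b : CompOn d (I ∪ Z) => hY b.1
  have hYZ := fun b : CompOn d Z => hY b.1
  have hYJ := fun b : CompOn d J => hY b.1
  choose W hWK hW using fun a : CompOn d J =>
    exists_wiener_filter (y := fun b : CompOn d (I ∪ Z) => Y b.1) (x := Y a.1)
      (Φ := Φ.submatrix Subtype.val Subtype.val) (fun b c t s => hΦ b.1 c.1 t s)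
      (φ := fun c => Φ a.1 c.1) (fun c t s => hΦ a.1 c.1 t s) hdet hK
  have hWT : ∀ a b, W a b ∈ T := fun a b => (hTK _).2 (hWK a b)
  have hrel : ∀ V : CompOn d (I ∪ Z) → tfRing, ∑ b, V b • Y b.1 = 0 → V = 0 := fun V hV =>
    eq_zero_of_sum_tf_smul_eq_zero (y := fun b : CompOn d (I ∪ Z) => Y b.1)
      (Φ := Φ.submatrix Subtype.val Subtype.val) (fun b c t s => hΦ b.1 c.1 t s) hdet hV
  -- The error of `W` is orthogonal to all outputs of filters in `T`, so the excess error of `V` is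
  -- the norm of the output of `W - V`. Equality of errors will give a linear relation, which `hrel`
  -- turns into `V = W`.
  have hpyth : ∀ (a : CompOn d J) (V : CompOn d (I ∪ Z) → tfRing), (∀ b, V b ∈ T) → ∀ t,
      ‖Y a.1 t - (∑ b, V b • Y b.1 : ℤ →ᵇ Lp ℝ 2 μ) t‖ ^ 2 =
        ‖Y a.1 t - (∑ b, W a b • Y b.1 : ℤ →ᵇ Lp ℝ 2 μ) t‖ ^ 2 +
          ‖(∑ b, (W a b - V b) • Y b.1 : ℤ →ᵇ Lp ℝ 2 μ) t‖ ^ 2 := by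
    intro a V hV t
    have h1 := inner_estimate_eq_zero (y := fun b : CompOn d (I ∪ Z) => Y b.1)
      (r := Y a.1 - ∑ b, W a b • Y b.1) (hW a) (V := fun b => W a b - V b)
      (fun b => (hTK _).1 (T.sub_mem (hWT a b) (hV b))) t
    have h2 : Y a.1 t - (∑ b, V b • Y b.1 : ℤ →ᵇ Lp ℝ 2 μ) t =
        (Y a.1 t - (∑ b, W a b • Y b.1 : ℤ →ᵇ Lp ℝ 2 μ) t) +
          (∑ b, (W a b - V b) • Y b.1 : ℤ →ᵇ Lp ℝ 2 μ) t := by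
      simp only [sub_smul, Finset.sum_sub_distrib, BoundedContinuousFunction.sub_apply]
      abel
    rw [h2, norm_add_sq_real]
    rw [BoundedContinuousFunction.sub_apply] at h1
    rw [h1]
    ring
  have hrep : ∀ a, Represents μ
      (applyTF (fun a b => (W a b : RatFunc ℝ)) (restrictTo y (I ∪ Z)) a)
      (∑ b, W a b • Y b.1) := fun a =>
    Represents.applyTF (X := fun b : CompOn d (I ∪ Z) => Y b.1) hYIZ fun _ => rfl
  have hfilter : IsWienerFilter μ 𝒯 (restrictTo y (I ∪ Z)) (restrictTo y J)
      (fun a b => (W a b : RatFunc ℝ)) := by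
    refine ⟨fun a b => h𝒯.coe_mem (hWT a b),
      (isWienerEstimate_iff h𝒯 hYIZ hYJ hrep).2 ⟨fun a => ?_, fun R' hR' t => ?_⟩⟩
    · exact Submodule.sum_mem _ fun b _ => Submodule.smul_mem _ (⟨W a b, hWT a b⟩ : T)
        (Submodule.subset_span ⟨b, rfl⟩)
    · refine Finset.sum_le_sum fun a _ => ?_
      obtain ⟨V, hV⟩ := (Submodule.mem_span_range_iff_exists_fun T).1 (hR' a)
      have := hpyth a (fun b => (V b : tfRing)) (fun b => (V b).2) t
      rw [← hV]
      exact (le_add_of_nonneg_right (sq_nonneg _)).trans this.ge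
  refine ⟨_, hfilter, fun W' hW' => ?_, fun a b hb => ?_⟩
  · obtain ⟨V, hV⟩ := h𝒯.exists_lift hW'.1
    have hrep' : ∀ a, Represents μ (applyTF W' (restrictTo y (I ∪ Z)) a)
        (∑ b, (V a b : tfRing) • Y b.1) := fun a =>
      Represents.applyTF (X := fun b : CompOn d (I ∪ Z) => Y b.1) hYIZ (hV a)
    have hopt := ((isWienerEstimate_iff h𝒯 hYIZ hYJ hrep').1 hW'.2).2 _
      ((isWienerEstimate_iff h𝒯 hYIZ hYJ hrep).1 hfilter.2).1
    ext a b
    have hzero : ∑ b, (W a b - V a b) • Y b.1 = 0 := by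
      ext1 t
      have h1 := hopt t
      simp only [fun a => hpyth a (fun b => (V a b : tfRing)) (fun b => (V a b).2) t,
        Finset.sum_add_distrib] at h1
      have h2 : ∑ a, ‖(∑ b, (W a b - V a b) • Y b.1 : ℤ →ᵇ Lp ℝ 2 μ) t‖ ^ 2 = 0 :=
        le_antisymm (by linarith) (Finset.sum_nonneg fun _ _ => sq_nonneg _)
      have h3 := (Finset.sum_eq_zero_iff_of_nonneg fun _ _ => sq_nonneg _).1 h2 a
        (Finset.mem_univ a)
      exact norm_eq_zero.1 (pow_eq_zero_iff two_ne_zero |>.1 h3)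
    have h1 := congrFun (hrel _ hzero) b
    rw [← hV, sub_eq_zero.1 h1]
  -- The optimal estimate is also one from `y_Z`, hence the output of a filter that is zero on
  -- `y_I`; the absence of linear relations identifies this filter with `W`.
  · have hZest := (h.estimatesCoincide h𝒯 hY _).1 hfilter.2
    have hspan := ((isWienerEstimate_iff h𝒯 hYZ hYJ hrep).1 hZest).1 a
    obtain ⟨V, hV⟩ := (Submodule.mem_span_range_iff_exists_fun T).1 hspan
    set V' : CompOn d (I ∪ Z) → tfRing := fun b =>
      if hb : b.1.1 ∈ Z then (V ⟨b.1, hb⟩ : tfRing) else 0 with hV'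
    have hsum : ∑ b, V' b • Y b.1 = ∑ b, (V b : tfRing) • Y b.1 := by
      let f : CompOn d Z → CompOn d (I ∪ Z) := fun c => ⟨c.1, Finset.mem_union_right _ c.2⟩
      have hf : Function.Injective f := fun c c' hc => by
        simpa [f, Subtype.ext_iff] using hc
      symm
      refine Fintype.sum_of_injective f hf _ _ (fun b hb => ?_) fun c => ?_
      · have : ¬ b.1.1 ∈ Z := fun hbZ => hb ⟨⟨b.1, hbZ⟩, rfl⟩
        simp [hV', this]
      · simp [hV', f, c.2]
    have hzero : ∑ b, (W a b - V' b) • Y b.1 = 0 := by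
      simp only [sub_smul, Finset.sum_sub_distrib]
      rw [hsum, sub_eq_zero]
      exact hV.symm
    have h1 := congrFun (hrel _ hzero) b
    have h2 : V' b = 0 := by
      have : ¬ b.1.1 ∈ Z := Finset.disjoint_left.1 hIZ hb
      simp [hV', this]
    have h3 : W a b = 0 := by simpa [h2] using h1
    rw [h3]
    rfl

end Separation

/-! ### Linear dynamic influence models -/

/-- The components of the nodes in `S`. -/
def compFinset {V : Type*} [Fintype V] [DecidableEq V] (d : V → ℕ) (S : Finset V) :
    Finset (Comp d) := Finset.univ.filter fun c => c.1 ∈ S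

@[simp]
theorem mem_compFinset {V : Type*} [Fintype V] [DecidableEq V] {d : V → ℕ} {S : Finset V}
    {c : Comp d} : c ∈ compFinset d S ↔ c.1 ∈ S := by
  simp [compFinset]

theorem compFinset_union {V : Type*} [Fintype V] [DecidableEq V] (d : V → ℕ) (S S' : Finset V) :
    compFinset d (S ∪ S') = compFinset d S ∪ compFinset d S' := by
  ext c
  simp

theorem disjoint_compFinset {V : Type*} [Fintype V] [DecidableEq V] (d : V → ℕ) {S S' : Finset V}
    (h : Disjoint S S') : Disjoint (compFinset d S) (compFinset d S') :=
  Finset.disjoint_left.2 fun _ hc hc' =>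
    Finset.disjoint_left.1 h (mem_compFinset.1 hc) (mem_compFinset.1 hc')

namespace LDIM

variable {V Ω : Type*} [Fintype V] [DecidableEq V] [MeasurableSpace Ω] {μ : Measure Ω}
  {d m : V → ℕ} {L : LDIM μ d m} {𝒯 : Set (RatFunc ℝ)} {T : Subring tfRing}

/-- The given identity over the rational functions descends to `T` by injectivity. For square
matrices over a commutative ring a right inverse is two-sided; padding by zeros then gives a matrix
on all components. -/
theorem exists_isBlockInverse (hL : L.InvertibleIn 𝒯) (h𝒯 : IsClassOf 𝒯 T)
    {Q : Matrix (Comp d) (Comp d) T} (hQ : ∀ a b, ((Q a b : tfRing) : RatFunc ℝ) = L.Q a b)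
    (S : Finset V) : ∃ N, IsBlockInverse Q N (compFinset d S) := by
  obtain ⟨N₀, hN₀, hmem⟩ := hL S
  obtain ⟨N₁, hN₁⟩ := h𝒯.exists_lift hmem
  let f : T →+* RatFunc ℝ := tfRing.subtype.comp T.subtype
  have hf : Function.Injective f := Subtype.val_injective.comp Subtype.val_injective
  have hmul : (1 - Q.submatrix (Subtype.val : CompOn d S → Comp d) Subtype.val) * N₁ = 1 := by
    refine Matrix.map_injective hf ?_
    change f.mapMatrix _ = f.mapMatrix _
    rw [map_mul, map_sub, map_one]
    convert! hN₀ using 3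
    · ext a b
      exact hQ a.1 b.1
    · ext a b
      exact hN₁ a b
  have hmul' := mul_eq_one_comm.1 hmul
  let N : Matrix (Comp d) (Comp d) T := fun a b =>
    if h : a.1 ∈ S ∧ b.1 ∈ S then N₁ ⟨a, h.1⟩ ⟨b, h.2⟩ else 0
  have hsum : ∀ g : Comp d → T, (∀ c, c.1 ∉ S → g c = 0) →
      ∑ c, g c = ∑ c : CompOn d S, g c.1 := by
    intro g hg
    symm
    refine Fintype.sum_of_injective Subtype.val Subtype.val_injective _ _ (fun c hc => ?_)
      fun _ => rfl
    exact hg c fun h => hc ⟨⟨c, h⟩, rfl⟩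
  have hone : ∀ a b : CompOn d S, (1 : Matrix (Comp d) (Comp d) T) a.1 b.1 =
      (1 : Matrix (CompOn d S) (CompOn d S) T) a b := fun a b => by
    simp [Matrix.one_apply, Subtype.ext_iff]
  refine ⟨N, fun a b ha => ?_, fun a b hb => ?_, fun a ha b hb => ?_, fun a ha b hb => ?_⟩
  · rw [mem_compFinset] at ha
    simp [N, ha]
  · rw [mem_compFinset] at hb
    simp [N, hb]
  · rw [mem_compFinset] at ha hb
    rw [hone ⟨a, ha⟩ ⟨b, hb⟩, ← hmul, Matrix.mul_apply, Matrix.mul_apply, hsum]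
    · refine Finset.sum_congr rfl fun c _ => ?_
      simp [N, c.2, hb, hone ⟨a, ha⟩ c]
    · intro c hc
      simp [N, hc]
  · rw [mem_compFinset] at ha hb
    rw [hone ⟨a, ha⟩ ⟨b, hb⟩, ← hmul', Matrix.mul_apply, Matrix.mul_apply, hsum]
    · refine Finset.sum_congr rfl fun c _ => ?_
      simp [N, c.2, ha, hone c ⟨b, hb⟩]
    · intro c hc
      simp [N, hc]

/-- The equations of the model in terms of bounded sequences. -/
theorem represents_dynamics {Q : Matrix (Comp d) (Comp d) tfRing}
    (hQ : ∀ a b, (Q a b : RatFunc ℝ) = L.Q a b) {P : Matrix (Comp d) (Comp m) tfRing}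
    (hP : ∀ a b, (P a b : RatFunc ℝ) = L.P a b) {Y : Comp d → ℤ →ᵇ Lp ℝ 2 μ}
    (hY : ∀ c, Represents μ (L.y c) (Y c)) {U : Comp m → ℤ →ᵇ Lp ℝ 2 μ}
    (hU : ∀ c, Represents μ (L.u c) (U c)) (c : Comp d) :
    Y c = ∑ b, Q c b • Y b + ∑ b, P c b • U b := by
  refine (hY c).unique fun t => (L.dynamics c t).trans ?_
  filter_upwards [Represents.applyTF hY (hQ c) t, Represents.applyTF hU (hP c) t,
    Lp.coeFn_add ((∑ b, Q c b • Y b : ℤ →ᵇ Lp ℝ 2 μ) t)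
      ((∑ b, P c b • U b : ℤ →ᵇ Lp ℝ 2 μ) t)] with ω h1 h2 h3
  rw [h1, h2]
  exact h3.symm

theorem inner_white {U : Comp m → ℤ →ᵇ Lp ℝ 2 μ} (hU : ∀ c, Represents μ (L.u c) (U c))
    (a b : Comp m) (t s : ℤ) :
    inner ℝ (U a t) (U b s) = if a = b ∧ t = s then (1 : ℝ) else 0 := by
  rw [(hU a).inner_eq (hU b), L.u_white.corr]

/-- The inputs of different nodes are uncorrelated. -/
theorem seqOrthogonal_input {P : Matrix (Comp d) (Comp m) tfRing}
    (hP : ∀ a b, (P a b : RatFunc ℝ) = L.P a b) {U : Comp m → ℤ →ᵇ Lp ℝ 2 μ}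
    (hU : ∀ c, Represents μ (L.u c) (U c)) {a b : Comp d} (hab : a.1 ≠ b.1) :
    SeqOrthogonal (∑ c, P a c • U c) (∑ c, P b c • U c) := by
  have hzero : ∀ a c, a.1 ≠ c.1 → P a c = 0 := fun a c h =>
    Subtype.ext ((hP a c).trans (L.P_blockDiagonal a c h))
  refine .sum_left fun c _ => SeqOrthogonal.symm (.sum_left fun c' _ => ?_)
  by_cases hc : a.1 = c.1
  · by_cases hc' : b.1 = c'.1
    · refine SeqOrthogonal.smul_left (SeqOrthogonal.symm (SeqOrthogonal.smul_left ?_ _)) _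
      intro t s
      rw [inner_white hU, if_neg]
      rintro ⟨rfl, -⟩
      exact hab (hc.trans hc'.symm)
    · rw [hzero b c' hc', zero_smul]
      exact .zero_left _
  · rw [hzero a c hc, zero_smul]
    exact (SeqOrthogonal.zero_left _).symm

/-- As `I ⊆ K`, an estimate from `(y_I, y_Z)` is one from `(y_K, y_Z)`, to which the algebraic
splitting applies. The two resulting differences involve inputs of disjoint sets of nodes. The
inputs enter only as processes, so `P` is lifted to `tfRing` and need not have entries in `T`. -/
theorem separatedBy (hL : L.InvertibleIn 𝒯) (h𝒯 : IsClassOf 𝒯 T) (hQ𝒯 : ∀ a b, L.Q a b ∈ 𝒯)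
    {G : Digraph V} (hG : L.IsRepresentedBy G) {I Z J : Finset V} (hIZ : Disjoint I Z)
    (hZJ : Disjoint Z J) (hsep : DSep G I Z J) {Y : Comp d → ℤ →ᵇ Lp ℝ 2 μ}
    (hY : ∀ c, Represents μ (L.y c) (Y c)) : SeparatedBy T Y I Z J := by
  obtain ⟨Q, hQ⟩ := h𝒯.exists_lift hQ𝒯
  obtain ⟨P, hP⟩ := isClassOf_tfF.exists_lift fun a b => (L.P_mem a b).1
  obtain ⟨U, hU⟩ := L.u_white.exists_represents
  have hdyn := represents_dynamics (Q := fun a b => (Q a b : tfRing)) hQ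
    (P := fun a b => (P a b : tfRing)) hP hY hU
  obtain ⟨K, K', ZK, ZK', rfl, hKK', hKZ, hK'Z, hZK, hIK, hJK', hpar, hpar'⟩ :=
    hsep.exists_sides hIZ hZJ
  have hQ0 : ∀ c b : Comp d, ¬ G.Adj b.1 c.1 → Q c b = 0 := fun c b h =>
    Subtype.ext (Subtype.ext ((hQ c b).trans (hG b.1 c.1 h c.2 b.2)))
  obtain ⟨NK, hNK⟩ := exists_isBlockInverse hL h𝒯 hQ K
  obtain ⟨NK', hNK'⟩ := exists_isBlockInverse hL h𝒯 hQ K'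
  obtain ⟨NA, hNA⟩ := exists_isBlockInverse hL h𝒯 hQ (K ∪ K' ∪ (ZK ∪ ZK'))
  have hQK : ∀ c ∈ compFinset d K ∪ compFinset d ZK, ∀ b, b ∉ compFinset d K →
      b ∉ compFinset d ZK ∪ compFinset d ZK' → Q c b = 0 := fun c hc b h1 h2 => by
    rw [← compFinset_union, mem_compFinset] at hc h2
    rw [mem_compFinset] at h1
    exact hQ0 c b (hpar c.1 hc b.1 h1 h2)
  have hQK' : ∀ c ∈ compFinset d K' ∪ compFinset d ZK', ∀ b, b ∉ compFinset d K' →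
      b ∉ compFinset d ZK ∪ compFinset d ZK' → Q c b = 0 := fun c hc b h1 h2 => by
    rw [← compFinset_union, mem_compFinset] at hc h2
    rw [mem_compFinset] at h1
    exact hQ0 c b (hpar' c.1 hc b.1 h1 h2)
  rw [compFinset_union, compFinset_union, compFinset_union] at hNA
  intro a q hq
  have hq1 : q ∈ Submodule.span T
      (Y '' (compFinset d K ∪ (compFinset d ZK ∪ compFinset d ZK') : Finset (Comp d))) := by
    rw [nodeSpan_eq] at hq
    rw [← compFinset_union, ← compFinset_union]
    refine Submodule.span_mono (Set.image_mono fun c hc => ?_) hq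
    exact mem_compFinset.2 (Finset.union_subset_union_left hIK hc)
  have hdisj := disjoint_compFinset d hKZ
  have hdisj' := disjoint_compFinset d hK'Z
  rw [compFinset_union] at hdisj hdisj'
  obtain ⟨q', hq', h1, h2⟩ := exists_estimate_of_partition (disjoint_compFinset d hKK') hdisj hdisj'
    hNK hNK' hNA hQK hQK' (e := fun c => ∑ b, (P c b : tfRing) • U b) hdyn
    (mem_compFinset.2 (hJK' a.2)) hq1
  refine ⟨q', ?_, SeqOrthogonal.of_mem_span ?_ h1 h2⟩
  · rw [nodeSpan_eq]
    rw [← compFinset_union] at hq'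
    exact Submodule.span_mono (Set.image_mono fun c hc => mem_compFinset.1 hc) hq'
  · rintro _ ⟨c, hc, rfl⟩ _ ⟨c', hc', rfl⟩
    refine seqOrthogonal_input hP hU fun hcc => ?_
    rw [← compFinset_union, Finset.mem_coe, mem_compFinset] at hc hc'
    rw [hcc] at hc
    have hdis : Disjoint (K' ∪ ZK') (K ∪ ZK) := by
      rw [Finset.disjoint_union_right] at hKZ hK'Z
      rw [Finset.disjoint_union_left, Finset.disjoint_union_right, Finset.disjoint_union_right]
      exact ⟨⟨hKK'.symm, hK'Z.1⟩, hKZ.2.symm, hZK.symm⟩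
    exact Finset.disjoint_left.1 hdis hc hc'

/-- The spectrum of the signals is rational. -/
theorem exists_spectrum (hL : L.IsWellPosed) {Y : Comp d → ℤ →ᵇ Lp ℝ 2 μ}
    (hY : ∀ c, Represents μ (L.y c) (Y c)) : ∃ Φ : Matrix (Comp d) (Comp d) tfRing,
      ∀ b c t s, inner ℝ (Y b t) (Y c s) = resp (Φ b c) (t - s) := by
  obtain ⟨Q, hQ⟩ := isClassOf_tfF.exists_lift L.Q_mem
  obtain ⟨P, hP⟩ := isClassOf_tfF.exists_lift fun a b => (L.P_mem a b).1
  obtain ⟨U, hU⟩ := L.u_white.exists_represents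
  -- Well-posedness for the set of all nodes expresses `y` as filtered white noise, `(1 - Q)⁻¹ P u`.
  obtain ⟨N, hN⟩ := exists_isBlockInverse hL isClassOf_tfF hQ Finset.univ
  have hdyn := represents_dynamics (Q := fun a b => (Q a b : tfRing)) hQ
    (P := fun a b => (P a b : tfRing)) hP hY hU
  have hYU : ∀ c, Y c = ∑ b, (∑ a, (N c a : tfRing) * P a b) • U b := by
    intro c
    have h1 := hN.sum_smul_sub (x := Y) (fun b hb => absurd (mem_compFinset.2 (by simp)) hb)
      (c := c) (mem_compFinset.2 (by simp))
    rw [← h1]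
    simp only [Finset.sum_smul]
    rw [Finset.sum_comm]
    refine Finset.sum_congr rfl fun a _ => ?_
    have h2 : Y a - ∑ b, Q a b • Y b = ∑ b, (P a b : tfRing) • U b := by
      rw [sub_eq_iff_eq_add']
      exact hdyn a
    rw [h2]
    simp only [mul_smul, ← Finset.smul_sum]
    rfl
  choose Φ hΦ using fun b c => exists_spectrum_of_white (inner_white hU)
    (fun k => ∑ a, (N b a : tfRing) * P a k) (fun k => ∑ a, (N c a : tfRing) * P a k)
  refine ⟨Φ, fun b c t s => ?_⟩
  rw [hYU b, hYU c, hΦ]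

/-- Evaluating the block of `Φ` at a point of the circle gives the power spectral density there,
whose determinant is positive; so the determinant has no zero on the circle. -/
theorem isUnit_det_spectrum {Y : Comp d → ℤ →ᵇ Lp ℝ 2 μ}
    (hY : ∀ c, Represents μ (L.y c) (Y c)) {Φ : Matrix (Comp d) (Comp d) tfRing}
    (hΦ : ∀ b c t s, inner ℝ (Y b t) (Y c s) = resp (Φ b c) (t - s)) {S : Finset V}
    (hpos : ∀ z : ℂ, ‖z‖ = 1 → (psd μ (restrictTo L.y S) z).PosDef) :
    IsUnit (Φ.submatrix (Subtype.val : CompOn d S → Comp d) Subtype.val).det := by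
  refine isUnit_tfRing fun z hz => ?_
  rw [RingHom.map_det]
  have hpsd : (tfEvalHom z hz).mapMatrix
      (Φ.submatrix (Subtype.val : CompOn d S → Comp d) Subtype.val) =
        psd μ (restrictTo L.y S) z := by
    ext a b
    refine (hasSum_resp (Φ a.1 b.1) z hz).tsum_eq.symm.trans ?_
    refine tsum_congr fun τ => ?_
    have := hΦ a.1 b.1 τ 0
    rw [(hY a.1).inner_eq (hY b.1), sub_zero] at this
    rw [← this]
    rfl
  rw [hpsd]
  exact (hpos z hz).det_pos.ne'

/-- Here `K` is the set of delays that filters in `T` may use: all integers, or the nonnegative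
ones. Ordinary well-posedness serves only to make the spectrum rational. -/
theorem wienerSepIn (hwp : L.IsWellPosed) (hL : L.InvertibleIn 𝒯) (h𝒯 : IsClassOf 𝒯 T)
    (hQ𝒯 : ∀ a b, L.Q a b ∈ 𝒯) {K : Set ℤ} (hK : K = Set.univ ∨ K = Set.Ici 0)
    (hTK : ∀ P, P ∈ T ↔ ∀ k ∉ K, resp P k = 0) {G : Digraph V} (hG : L.IsRepresentedBy G)
    {I Z J : Finset V} (hIZ : Disjoint I Z) (hZJ : Disjoint Z J) (hsep : DSep G I Z J) :
    WienerSepIn μ 𝒯 L.y I Z J := by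
  obtain ⟨Y, hY⟩ := L.y_wss.exists_represents
  have h := separatedBy hL h𝒯 hQ𝒯 hG hIZ hZJ hsep hY
  obtain ⟨Φ, hΦ⟩ := exists_spectrum hwp hY
  exact ⟨h.estimatesCoincide h𝒯 hY, h.noImprovement h𝒯 hY, fun hpos =>
    h.filterVanishesOn h𝒯 hY hIZ hΦ (isUnit_det_spectrum hY hΦ hpos) hK hTK⟩

end LDIM

end

theorem mainTheorem1 {V Ω : Type*} [Fintype V] [DecidableEq V] [MeasurableSpace Ω]
    (μ : Measure Ω) [IsProbabilityMeasure μ] (d m : V → ℕ) (L : LDIM μ d m)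
    (hwp : L.IsWellPosed) (G : Digraph V) (hG : L.IsRepresentedBy G)
    (I Z J : Finset V) (hIZ : Disjoint I Z) (hIJ : Disjoint I J) (hZJ : Disjoint Z J)
    (hsep : DSep G I Z J) :
    WSep μ L.y I Z J ∧
      (L.IsCausal → L.IsCausallyWellPosed → CWSep μ L.y I Z J) :=
  ⟨LDIM.wienerSepIn hwp hwp isClassOf_tfF L.Q_mem (Or.inl rfl) (fun P => by simp) hG hIZ hZJ hsep,
    fun hcausal hcwp => LDIM.wienerSepIn hwp hcwp isClassOf_tfFplus hcausal (Or.inr rfl)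
      (fun P => by simp [causalRing, ← Subring.mem_carrier]) hG hIZ hZJ hsep⟩
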